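/- For $c\in\mathbb R$ let $M^2(c)$ be the complete simply connected surface of constant curvature $c$ (a sphere, the Euclidean plane or a hyperbolic plane). Let $c_1,c_2\in\mathbb R$ be not both $0$, let $\widetilde g$ be the product metric of $M^2(c_1)\times M^2(c_2)$, and let $F(v_1+v_2)=v_1-v_2$ be its product structure ($v_i$ tangent to the $i$-th factor). Let $\psi:M\to M^2(c_1)\times M^2(c_2)$ be a smooth immersed surface with induced metric $g$, Levi-Civita connection $\nabla$, normal connection $\nabla^\perp$ and shape operators $S_\xi$, so that the Levi-Civita connection $\widetilde\nabla$ of the product satisfies $\widetilde\nabla_X\xi=-S_\xi X+\nabla^\perp_X\xi$. For $X$ tangent and $\xi$ normal to $M$ let $fX$ be the tangential part of $FX$ and $t\xi$ the normal part of $F\xi$, and let $\lambda_1\le\lambda_2$ be the eigenvalues of the symmetric operator $f$ (with multiplicity). Let $\theta\in[0,\frac{\pi}{2}]$. (1) Suppose that $\lambda_1=-1$ everywhere and that $\lambda_2=\cos(2\theta)\in(-1,1)$ is constant. Then every point of $M$ has an open neighbourhood with a smooth orthonormal frame $\{e_1,e_2,\xi_1,\xi_2\}$, where $e_1,e_2$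 are tangent and $\xi_1,\xi_2$ are normal to $M$, such that $$fe_1=-e_1,\quad fe_2=\cos(2\theta)e_2,\quad t\xi_1=\xi_1,\quad t\xi_2=-\cos(2\theta)\xi_2,$$ and smooth functions $\mu_1,\mu_2$ on this neighbourhood such that, with respect to $\{e_1,e_2\}$, $$S_{\xi_1}=\begin{pmatrix}0&0\\0&\mu_1\end{pmatrix},\qquad S_{\xi_2}=\begin{pmatrix}\mu_2&0\\0&0\end{pmatrix},$$ and, for every tangent vector field $X$, $$g(\nabla_Xe_1,e_2)=-\tan(\theta)\,\mu_2\,g(X,e_1),\qquad \widetilde g(\nabla^\perp_X\xi_1,\xi_2)=-\tan(\theta)\,\mu_1\,g(X,e_2).$$ Moreover, the Gaussian curvature of $M$ is $K=c_2\sin^2(\theta)$ and its normal curvature $K^\perp=|\widetilde g(R^\perp(e_1,e_2)\xi_2,\xi_1)|$, where $R^\perp$ is the curvature of $\nabla^\perp$, is $0$. (2) Suppose that $\lambda_1=\cos(2\theta)\in(-1,1)$ is constant and that $\lambda_2=1$ everywhere. Then every point of $M$ has an open neighbourhood with a smooth orthonormal frame $\{e_1,e_2,\xi_1,\xi_2\}$,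 where $e_1,e_2$ are tangent and $\xi_1,\xi_2$ are normal to $M$, such that $$fe_1=\cos(2\theta)e_1,\quad fe_2=e_2,\quad t\xi_1=-\cos(2\theta)\xi_1,\quad t\xi_2=-\xi_2,$$ and smooth functions $\mu_1,\mu_2$ on this neighbourhood such that $S_{\xi_1}$ and $S_{\xi_2}$ have the same matrix form as in (1) and, for every tangent vector field $X$, $$g(\nabla_Xe_1,e_2)=-\cot(\theta)\,\mu_1\,g(X,e_2),\qquad \widetilde g(\nabla^\perp_X\xi_1,\xi_2)=-\cot(\theta)\,\mu_2\,g(X,e_1).$$ Moreover, the Gaussian curvature of $M$ is $K=c_1\cos^2(\theta)$ and the normal curvature is $K^\perp=0$. -/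

import Mathlib

open scoped Manifold ContDiff Topology

noncomputable section

namespace ConstantAngle

/-! ### The space forms `M²(c)` and their product -/

/-- Ambient three-space of the standard model of `M²(c)`; only its linear and smooth structure is
used, the metric is given by `form`. -/
abbrev Amb : Type := EuclideanSpace ℝ (Fin 3)

/-- The Euclidean inner product of `ℝ³` if `c ≥ 0`, the Lorentzian product
`-u₀v₀ + u₁v₁ + u₂v₂` if `c < 0`. -/
def form (c : ℝ) (u v : Amb) : ℝ :=
  (if c < 0 then -1 else 1) * (u 0 * v 0) + u 1 * v 1 + u 2 * v 2

/-- The complete simply connected surface `M²(c)` of constant curvature `c`: the sphere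
`⟨p,p⟩ = 1/c` if `c > 0`, the upper sheet of the hyperboloid `⟨p,p⟩₁ = 1/c` if `c < 0`, and the
Euclidean plane `p₀ = 0` if `c = 0`. -/
def spaceForm (c : ℝ) : Set Amb :=
  {p | if c = 0 then p 0 = 0 else form c p p = 1 / c ∧ (c < 0 → 0 < p 0)}

/-- A vector normal to `M²(c)` at `p`: the position vector if `c ≠ 0`, the first basis vector if
`c = 0`. -/
def normalVec (c : ℝ) (p : Amb) : Amb :=
  if c = 0 then EuclideanSpace.single 0 1 else p

/-- The orthogonal projection of `ℝ³` (or `ℝ³₁`) onto the tangent plane `T_p M²(c)`. -/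
def projTangent (c : ℝ) (p v : Amb) : Amb :=
  v - (form c (normalVec c p) v / form c (normalVec c p) (normalVec c p)) • normalVec c p

/-- The tangent space of `M²(c₁) × M²(c₂)` at `p`, a subset of `ℝ³ × ℝ³`. -/
def prodTangent (c₁ c₂ : ℝ) (p : Amb × Amb) : Set (Amb × Amb) :=
  {v | form c₁ (normalVec c₁ p.1) v.1 = 0 ∧ form c₂ (normalVec c₂ p.2) v.2 = 0}

/-- The product metric `g̃`. -/
def prodMetric (c₁ c₂ : ℝ) (v w : Amb × Amb) : ℝ :=
  form c₁ v.1 w.1 + form c₂ v.2 w.2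

/-- The product structure `F (v₁ + v₂) = v₁ - v₂`. -/
def prodStructure (v : Amb × Amb) : Amb × Amb := (v.1, -v.2)

/-! ### Immersed surfaces in `M²(c₁) × M²(c₂)` -/

variable {M : Type*} [TopologicalSpace M] [ChartedSpace (EuclideanSpace ℝ (Fin 2)) M]

/-- `ψ` is a smooth immersion of the surface `M` into `M²(c₁) × M²(c₂)`. -/
structure IsImmersedSurface (c₁ c₂ : ℝ) (ψ : M → Amb × Amb) : Prop where
  smooth : ContMDiff (𝓡 2) 𝓘(ℝ, Amb × Amb) ∞ ψ
  mem : ∀ p, (ψ p).1 ∈ spaceForm c₁ ∧ (ψ p).2 ∈ spaceForm c₂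
  injective : ∀ p, Function.Injective (mvfderiv (𝓡 2) ψ p)

/-- The induced metric `g` of `M`. -/
def indMetric (c₁ c₂ : ℝ) (ψ : M → Amb × Amb) (p : M) (u v : TangentSpace (𝓡 2) p) : ℝ :=
  prodMetric c₁ c₂ (mvfderiv (𝓡 2) ψ p u) (mvfderiv (𝓡 2) ψ p v)

/-- The tangential component of an ambient vector `v` at `ψ p`: the unique `u ∈ T_pM` such that
`v - dψ u` is `g̃`-orthogonal to `dψ (T_pM)`. -/
def tanPart (c₁ c₂ : ℝ) (ψ : M → Amb × Amb) (p : M) (v : Amb × Amb) : TangentSpace (𝓡 2) p :=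
  Classical.epsilon fun u ↦ ∀ w : TangentSpace (𝓡 2) p,
    indMetric c₁ c₂ ψ p u w = prodMetric c₁ c₂ v (mvfderiv (𝓡 2) ψ p w)

/-- The normal component of an ambient vector `v` at `ψ p`. -/
def norPart (c₁ c₂ : ℝ) (ψ : M → Amb × Amb) (p : M) (v : Amb × Amb) : Amb × Amb :=
  v - mvfderiv (𝓡 2) ψ p (tanPart c₁ c₂ ψ p v)

/-- `v` lies in the normal space `T_p^⊥M`, the orthogonal complement of `dψ (T_pM)` in the tangent
space of `M²(c₁) × M²(c₂)` at `ψ p`. -/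
def IsNormal (c₁ c₂ : ℝ) (ψ : M → Amb × Amb) (p : M) (v : Amb × Amb) : Prop :=
  v ∈ prodTangent c₁ c₂ (ψ p) ∧
    ∀ w : TangentSpace (𝓡 2) p, prodMetric c₁ c₂ v (mvfderiv (𝓡 2) ψ p w) = 0

/-- The tangential component `f` of the product structure on tangent vectors. -/
def fTensor (c₁ c₂ : ℝ) (ψ : M → Amb × Amb) (p : M) (u : TangentSpace (𝓡 2) p) :
    TangentSpace (𝓡 2) p :=
  tanPart c₁ c₂ ψ p (prodStructure (mvfderiv (𝓡 2) ψ p u))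

/-- The normal component `t` of the product structure on normal vectors. -/
def tTensor (c₁ c₂ : ℝ) (ψ : M → Amb × Amb) (p : M) (v : Amb × Amb) : Amb × Amb :=
  norPart c₁ c₂ ψ p (prodStructure v)

/-- `l₁ ≤ l₂` are the eigenvalues of `f` at `p`, counted with multiplicity. -/
def HasPrincipalValuesAt (c₁ c₂ : ℝ) (ψ : M → Amb × Amb) (p : M) (l₁ l₂ : ℝ) : Prop :=
  l₁ ≤ l₂ ∧ ∃ b : Module.Basis (Fin 2) ℝ (TangentSpace (𝓡 2) p),
    fTensor c₁ c₂ ψ p (b 0) = l₁ • b 0 ∧ fTensor c₁ c₂ ψ p (b 1) = l₂ • b 1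

/-! ### Connections and curvatures -/

/-- `∇̃_u V`, for a field `V` along `ψ` tangent to `M²(c₁) × M²(c₂)`: the Levi-Civita connection of
`M²(c₁) × M²(c₂)` is the tangential projection of the flat derivative of the ambient space. -/
def ambConn (c₁ c₂ : ℝ) (ψ : M → Amb × Amb) (V : M → Amb × Amb) (p : M)
    (u : TangentSpace (𝓡 2) p) : Amb × Amb :=
  (projTangent c₁ (ψ p).1 (mvfderiv (𝓡 2) V p u).1,
    projTangent c₂ (ψ p).2 (mvfderiv (𝓡 2) V p u).2)

/-- The shape operator `S_ξ u = -(∇̃_u ξ)^⊤`. -/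
def shapeOp (c₁ c₂ : ℝ) (ψ : M → Amb × Amb) (ξ : M → Amb × Amb) (p : M)
    (u : TangentSpace (𝓡 2) p) : TangentSpace (𝓡 2) p :=
  -tanPart c₁ c₂ ψ p (ambConn c₁ c₂ ψ ξ p u)

/-- The normal connection `∇^⊥_u ξ = (∇̃_u ξ)^⊥`. -/
def normalConn (c₁ c₂ : ℝ) (ψ : M → Amb × Amb) (ξ : M → Amb × Amb) (p : M)
    (u : TangentSpace (𝓡 2) p) : Amb × Amb :=
  norPart c₁ c₂ ψ p (ambConn c₁ c₂ ψ ξ p u)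

variable [IsManifold (𝓡 2) ∞ M]

/-- The vector field `X` is smooth at `p`. -/
def SmoothFieldAt (X : ∀ q : M, TangentSpace (𝓡 2) q) (p : M) : Prop :=
  ContMDiffAt (𝓡 2) (𝓡 2).tangent ∞
    (fun q ↦ (⟨q, X q⟩ : TangentBundle (𝓡 2) M)) p

/-- The map `V` into the ambient space is smooth at `p`. -/
def SmoothMapAt (V : M → Amb × Amb) (p : M) : Prop :=
  ContMDiffAt (𝓡 2) 𝓘(ℝ, Amb × Amb) ∞ V p

/-- `∇_X Y` at `p` for the Levi-Civita connection `∇` of the induced metric: the vector determined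
by the Koszul formula. -/
def leviCivita (c₁ c₂ : ℝ) (ψ : M → Amb × Amb) (X Y : ∀ q : M, TangentSpace (𝓡 2) q) (p : M) :
    TangentSpace (𝓡 2) p :=
  Classical.epsilon fun u ↦ ∀ Z : ∀ q : M, TangentSpace (𝓡 2) q, SmoothFieldAt Z p →
    2 * indMetric c₁ c₂ ψ p u (Z p) =
      mvfderiv (𝓡 2) (fun q ↦ indMetric c₁ c₂ ψ q (Y q) (Z q)) p (X p)
      + mvfderiv (𝓡 2) (fun q ↦ indMetric c₁ c₂ ψ q (X q) (Z q)) p (Y p)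
      - mvfderiv (𝓡 2) (fun q ↦ indMetric c₁ c₂ ψ q (X q) (Y q)) p (Z p)
      + indMetric c₁ c₂ ψ p (VectorField.mlieBracket (𝓡 2) X Y p) (Z p)
      - indMetric c₁ c₂ ψ p (VectorField.mlieBracket (𝓡 2) X Z p) (Y p)
      - indMetric c₁ c₂ ψ p (VectorField.mlieBracket (𝓡 2) Y Z p) (X p)

/-- `R(X,Y)Z = ∇_X ∇_Y Z - ∇_Y ∇_X Z - ∇_{[X,Y]} Z`. -/
def curvature (c₁ c₂ : ℝ) (ψ : M → Amb × Amb) (X Y Z : ∀ q : M, TangentSpace (𝓡 2) q) (p : M) :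
    TangentSpace (𝓡 2) p :=
  leviCivita c₁ c₂ ψ X (leviCivita c₁ c₂ ψ Y Z) p
    - leviCivita c₁ c₂ ψ Y (leviCivita c₁ c₂ ψ X Z) p
    - leviCivita c₁ c₂ ψ (VectorField.mlieBracket (𝓡 2) X Y) Z p

/-- `R^⊥(X,Y)ξ = ∇^⊥_X ∇^⊥_Y ξ - ∇^⊥_Y ∇^⊥_X ξ - ∇^⊥_{[X,Y]} ξ`. -/
def normalCurvatureTensor (c₁ c₂ : ℝ) (ψ : M → Amb × Amb) (X Y : ∀ q : M, TangentSpace (𝓡 2) q)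
    (ξ : M → Amb × Amb) (p : M) : Amb × Amb :=
  normalConn c₁ c₂ ψ (fun q ↦ normalConn c₁ c₂ ψ ξ q (Y q)) p (X p)
    - normalConn c₁ c₂ ψ (fun q ↦ normalConn c₁ c₂ ψ ξ q (X q)) p (Y p)
    - normalConn c₁ c₂ ψ ξ p (VectorField.mlieBracket (𝓡 2) X Y p)

/-- `u, v` are orthonormal in `T_pM`. -/
def TanOrthonormal (c₁ c₂ : ℝ) (ψ : M → Amb × Amb) (p : M) (u v : TangentSpace (𝓡 2) p) : Prop :=
  indMetric c₁ c₂ ψ p u u = 1 ∧ indMetric c₁ c₂ ψ p v v = 1 ∧ indMetric c₁ c₂ ψ p u v = 0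

/-- `v, w` are `g̃`-orthonormal. -/
def AmbOrthonormal (c₁ c₂ : ℝ) (v w : Amb × Amb) : Prop :=
  prodMetric c₁ c₂ v v = 1 ∧ prodMetric c₁ c₂ w w = 1 ∧ prodMetric c₁ c₂ v w = 0

/-- The Gaussian curvature of `M` at `p` is `κ`: `g(R(X,Y)Y,X) = κ` for all smooth local vector
fields `X, Y` that are orthonormal at `p`. -/
def HasGaussianCurvatureAt (c₁ c₂ : ℝ) (ψ : M → Amb × Amb) (p : M) (κ : ℝ) : Prop :=
  ∀ X Y : ∀ q : M, TangentSpace (𝓡 2) q,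
    (∀ᶠ q in 𝓝 p, SmoothFieldAt X q ∧ SmoothFieldAt Y q) →
    TanOrthonormal c₁ c₂ ψ p (X p) (Y p) →
    indMetric c₁ c₂ ψ p (curvature c₁ c₂ ψ X Y Y p) (X p) = κ

/-- The normal curvature `K^⊥` of `M` at `p` is `κ`: `|g̃(R^⊥(X,Y)η,ξ)| = κ` for all smooth local
vector fields `X, Y` and normal fields `ξ, η` that are orthonormal at `p`. -/
def HasNormalCurvatureAt (c₁ c₂ : ℝ) (ψ : M → Amb × Amb) (p : M) (κ : ℝ) : Prop :=
  ∀ (X Y : ∀ q : M, TangentSpace (𝓡 2) q) (ξ η : M → Amb × Amb),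
    (∀ᶠ q in 𝓝 p, SmoothFieldAt X q ∧ SmoothFieldAt Y q ∧ SmoothMapAt ξ q ∧ SmoothMapAt η q ∧
      IsNormal c₁ c₂ ψ q (ξ q) ∧ IsNormal c₁ c₂ ψ q (η q)) →
    TanOrthonormal c₁ c₂ ψ p (X p) (Y p) → AmbOrthonormal c₁ c₂ (ξ p) (η p) →
    |prodMetric c₁ c₂ (normalCurvatureTensor c₁ c₂ ψ X Y η p) (ξ p)| = κ

/-- `{e₁, e₂, ξ₁, ξ₂}` is a smooth orthonormal frame over `U` with `e₁, e₂` tangent and `ξ₁, ξ₂`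
normal to `M`. -/
structure IsAdaptedFrame (c₁ c₂ : ℝ) (ψ : M → Amb × Amb) (U : Set M)
    (e₁ e₂ : ∀ q : M, TangentSpace (𝓡 2) q) (ξ₁ ξ₂ : M → Amb × Amb) : Prop where
  smooth_tangent : ∀ q ∈ U, SmoothFieldAt e₁ q ∧ SmoothFieldAt e₂ q
  smooth_normal : ∀ q ∈ U, SmoothMapAt ξ₁ q ∧ SmoothMapAt ξ₂ q
  isNormal : ∀ q ∈ U, IsNormal c₁ c₂ ψ q (ξ₁ q) ∧ IsNormal c₁ c₂ ψ q (ξ₂ q)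
  orthonormal_tangent : ∀ q ∈ U, TanOrthonormal c₁ c₂ ψ q (e₁ q) (e₂ q)
  orthonormal_normal : ∀ q ∈ U, AmbOrthonormal c₁ c₂ (ξ₁ q) (ξ₂ q)

/-- With respect to `{e₁, e₂}`, over `U`, the shape operators are
`S_{ξ₁} = diag(0, μ₁)` and `S_{ξ₂} = diag(μ₂, 0)`. -/
def HasSpecialShape (c₁ c₂ : ℝ) (ψ : M → Amb × Amb) (U : Set M)
    (e₁ e₂ : ∀ q : M, TangentSpace (𝓡 2) q) (ξ₁ ξ₂ : M → Amb × Amb) (μ₁ μ₂ : M → ℝ) : Prop :=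
  ∀ q ∈ U,
    shapeOp c₁ c₂ ψ ξ₁ q (e₁ q) = 0 ∧ shapeOp c₁ c₂ ψ ξ₁ q (e₂ q) = μ₁ q • e₂ q ∧
    shapeOp c₁ c₂ ψ ξ₂ q (e₁ q) = μ₂ q • e₁ q ∧ shapeOp c₁ c₂ ψ ξ₂ q (e₂ q) = 0

end ConstantAngle

end

namespace ConstantAngle

/-! Everything is computed with the flat derivative `D` of `ℝ³ × ℝ³`, since the Levi-Civita
connection, the shape operators and the normal connection are all orthogonal projections of it
(`leviCivita_eq`, `shapeOp_eq`, `prodMetric_normalConn`).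

In case (1) write `C = cos θ`, `S = sin θ`. From `⟨F e₁, e₁⟩ = -1` and `|e₁| = 1` the first
component of `dψ e₁` has length zero, so `e₁` is tangent to the second factor. Write `dψ e₂ = (a,
b)`; then `|a|² = C²` and `|b|² = S²`. The normal plane is spanned by `ξ₁`, which is `a` rotated by
a right angle inside the first factor and normalised, and by `ξ₂ = ((S/C) a, -(C/S) b)`. This is
`IsSpecialFrame`.

Since `|a|` and `|b|` are constant and `e₁`, `ξ₁` each live in one factor, all connection
coefficients of the frame reduce to the two 1-forms `α(u) = ⟨(D_u e₁)₂, b⟩` and `β(u) = ⟨(D_u ξ₁)₁,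
a⟩`. The vector `dψ [e₁, e₂] = D_{e₁} e₂ - D_{e₂} e₁` is tangent; pairing it with `ξ₁` gives `β(e₁)
= 0`, and with `ξ₂` gives `α(e₂) = 0`. Thus `α` and `β` are multiples of `g(·, e₁)` and `g(·, e₂)`,
and the shape operators and both connection formulas are read off.

The curvature of a plane bundle spanned by orthonormal `s₁, s₂` in a flat space is governed by `⟨D_Y
s₁, D_X s₂⟩ - ⟨D_X s₁, D_Y s₂⟩` (`pairProj_curvature`). For `e₁, e₂` only the components along the
position normal of the second factor contribute, which gives `c₂ S²`; for `ξ₁, ξ₂` nothing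
contributes.

Case (2) is case (1) after interchanging the factors: `F` becomes `-F`, the eigenvalues become `-1`
and `-cos 2θ = sin²θ - cos²θ`, and sine and cosine trade places. -/

theorem two_le_infty : (2 : ℕ∞ω) ≤ ∞ :=
  WithTop.coe_le_coe.2 (le_top : (2 : ℕ∞) ≤ ⊤)

/-! ### Derivatives of vector-valued maps on the surface, and Lie brackets. -/

section Calculus

variable {M : Type*} [TopologicalSpace M] [ChartedSpace (EuclideanSpace ℝ (Fin 2)) M]
  {F G : Type*} [NormedAddCommGroup F] [NormedSpace ℝ F] [NormedAddCommGroup G] [NormedSpace ℝ G]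

theorem mvfderiv_congr {V W : M → F} {p : M} (h : V =ᶠ[𝓝 p] W) :
    mvfderiv (𝓡 2) V p = mvfderiv (𝓡 2) W p := by
  unfold mvfderiv
  have := h.mfderiv_eq (I := 𝓡 2) (I' := 𝓘(ℝ, F))
  ext v
  simp [this]
  rfl

theorem mvfderiv_clm_comp (A : F →L[ℝ] G) {V : M → F} {p : M}
    (hV : MDifferentiableAt (𝓡 2) 𝓘(ℝ, F) V p) (u : TangentSpace (𝓡 2) p) :
    mvfderiv (𝓡 2) (fun q ↦ A (V q)) p u = A (mvfderiv (𝓡 2) V p u) := by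
  have h2 : MDifferentiableAt (𝓡 2) 𝓘(ℝ, G) (fun q ↦ A (V q)) p :=
    (A.mdifferentiableAt (x := V p)).comp p hV
  have h1 : DifferentiableWithinAt ℝ (writtenInExtChartAt (𝓡 2) 𝓘(ℝ, F) p V)
      (Set.range (𝓡 2)) (extChartAt (𝓡 2) p p) := hV.differentiableWithinAt_writtenInExtChartAt
  rw [h2.mvfderiv, hV.mvfderiv]
  exact congrArg (· u) (A.hasFDerivAt.comp_hasFDerivWithinAt _ h1.hasFDerivWithinAt
    |>.fderivWithin ((𝓡 2).uniqueDiffOn _ (by simp)))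

theorem mvfderiv_bilin (A : F →L[ℝ] F →L[ℝ] G) {V W : M → F} {p : M}
    (hV : MDifferentiableAt (𝓡 2) 𝓘(ℝ, F) V p) (hW : MDifferentiableAt (𝓡 2) 𝓘(ℝ, F) W p)
    (u : TangentSpace (𝓡 2) p) :
    mvfderiv (𝓡 2) (fun q ↦ A (V q) (W q)) p u =
      A (mvfderiv (𝓡 2) V p u) (W p) + A (V p) (mvfderiv (𝓡 2) W p u) := by
  have h2 : MDifferentiableAt (𝓡 2) 𝓘(ℝ, G) (fun q ↦ A (V q) (W q)) p :=
    ((A.mdifferentiableAt (x := V p)).comp p hV).clm_apply hW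
  have h1 : DifferentiableWithinAt ℝ (writtenInExtChartAt (𝓡 2) 𝓘(ℝ, F) p V)
      (Set.range (𝓡 2)) (extChartAt (𝓡 2) p p) := hV.differentiableWithinAt_writtenInExtChartAt
  have h3 : DifferentiableWithinAt ℝ (writtenInExtChartAt (𝓡 2) 𝓘(ℝ, F) p W)
      (Set.range (𝓡 2)) (extChartAt (𝓡 2) p p) := hW.differentiableWithinAt_writtenInExtChartAt
  rw [h2.mvfderiv, hV.mvfderiv, hW.mvfderiv]
  have := A.hasFDerivWithinAt_of_bilinear h1.hasFDerivWithinAt h3.hasFDerivWithinAt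
    |>.fderivWithin ((𝓡 2).uniqueDiffOn _ (by simp))
  have e1 : writtenInExtChartAt (𝓡 2) 𝓘(ℝ, F) p V (extChartAt (𝓡 2) p p) = V p := by
    simp [writtenInExtChartAt]; rfl
  have e2 : writtenInExtChartAt (𝓡 2) 𝓘(ℝ, F) p W (extChartAt (𝓡 2) p p) = W p := by
    simp [writtenInExtChartAt]; rfl
  rw [e1, e2] at this
  exact (congrArg (· u) this).trans (add_comm _ _)

variable [IsManifold (𝓡 2) ∞ M]

theorem SmoothFieldAt.mvfderiv_apply {X : ∀ q : M, TangentSpace (𝓡 2) q} {V : M → F} {p : M}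
    (hX : SmoothFieldAt X p) (hV : ContMDiffAt (𝓡 2) 𝓘(ℝ, F) ∞ V p) :
    ContMDiffAt (𝓡 2) 𝓘(ℝ, F) ∞ (fun q ↦ mvfderiv (𝓡 2) V q (X q)) p := by
  -- No order of smoothness is lost, because `∞ + 1 ≤ ∞`.
  have h1 := hV.mfderiv_const (m := ∞) (by simp)
  have h2 : ContMDiffAt (𝓡 2) (𝓘(ℝ, F)).tangent ∞
      (fun q ↦ (⟨V q, mfderiv (𝓡 2) 𝓘(ℝ, F) V q (X q)⟩ : TangentBundle 𝓘(ℝ, F) F)) p :=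
    ContMDiffAt.clm_apply_of_inCoordinates (b₁ := id) (b₂ := V) h1 hX hV
  exact (contMDiff_snd_tangentBundle_modelSpace F 𝓘(ℝ, F)).contMDiffAt.comp p h2

theorem SmoothFieldAt.mdifferentiableAt {X : ∀ q : M, TangentSpace (𝓡 2) q} {p : M}
    (hX : SmoothFieldAt X p) : MDifferentiableAt (𝓡 2) (𝓡 2).tangent
    (fun q ↦ (⟨q, X q⟩ : TangentBundle (𝓡 2) M)) p :=
  ContMDiffAt.mdifferentiableAt hX (by simp)

theorem SmoothFieldAt.mlieBracket {X Y : ∀ q : M, TangentSpace (𝓡 2) q} {p : M}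
    (hX : SmoothFieldAt X p) (hY : SmoothFieldAt Y p) :
    SmoothFieldAt (VectorField.mlieBracket (𝓡 2) X Y) p := by
  have : IsManifold (𝓡 2) (((⊤ : ℕ∞) : WithTop ℕ∞) + 1) M := by simpa
  have : IsManifold (𝓡 2) (minSmoothness ℝ 2) M :=
    IsManifold.of_le (n := ∞) (by simpa using two_le_infty)
  exact ContMDiffAt.mlieBracket_vectorField (n := ⊤) (m := ⊤) hX hY (by simp)

/-- The derivative along `X` in the chart at `p`. -/
theorem mvfderiv_eq_fderivWithin_chart {V : M → F} {p : M} {X : ∀ q : M, TangentSpace (𝓡 2) q}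
    {y : EuclideanSpace ℝ (Fin 2)} (hy : y ∈ (extChartAt (𝓡 2) p).target)
    (hV : MDifferentiableAt (𝓡 2) 𝓘(ℝ, F) V ((extChartAt (𝓡 2) p).symm y)) :
    mvfderiv (𝓡 2) V ((extChartAt (𝓡 2) p).symm y) (X ((extChartAt (𝓡 2) p).symm y)) =
      fderivWithin ℝ (V ∘ (extChartAt (𝓡 2) p).symm) (Set.range (𝓡 2)) y
        (VectorField.mpullbackWithin 𝓘(ℝ, EuclideanSpace ℝ (Fin 2)) (𝓡 2)
          (extChartAt (𝓡 2) p).symm X (Set.range (𝓡 2)) y) := by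
  have : IsManifold (𝓡 2) 1 M := IsManifold.of_le (n := ∞) (by simp)
  have h1 := isInvertible_mfderivWithin_extChartAt_symm (I := 𝓡 2) hy
  have h2 := mdifferentiableWithinAt_extChartAt_symm (I := 𝓡 2) hy
  have h3 := mfderiv_comp_mfderivWithin y hV h2
    (by simpa using uniqueMDiffWithinAt_univ (𝓘(ℝ, EuclideanSpace ℝ (Fin 2))))
  rw [← mfderivWithin_eq_fderivWithin, h3, VectorField.mpullbackWithin_apply]
  change _ = mfderiv (𝓡 2) 𝓘(ℝ, F) V _ ((mfderivWithin _ _ _ _ _) _)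
  rw [h1.self_apply_inverse]
  rfl

/-- The derivation along `[X, Y]` is the commutator of the derivations along `X` and `Y`. -/
theorem mvfderiv_commutator {V : M → F} {p : M} {X Y : ∀ q : M, TangentSpace (𝓡 2) q}
    (hV : ContMDiffAt (𝓡 2) 𝓘(ℝ, F) ∞ V p) (hX : SmoothFieldAt X p) (hY : SmoothFieldAt Y p) :
    mvfderiv (𝓡 2) V p (VectorField.mlieBracket (𝓡 2) X Y p) =
      mvfderiv (𝓡 2) (fun q ↦ mvfderiv (𝓡 2) V q (Y q)) p (X p) -
      mvfderiv (𝓡 2) (fun q ↦ mvfderiv (𝓡 2) V q (X q)) p (Y p) := by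
  have h1 : IsManifold (𝓡 2) 1 M := IsManifold.of_le (n := ∞) (by simp)
  have h2 : IsManifold (𝓡 2) 2 M := IsManifold.of_le (n := ∞) two_le_infty
  -- Iterated derivations become iterated derivatives in the chart at `p` along pulled-back fields,
  -- where the Euclidean commutator formula applies.
  have key : ∀ Z W : ∀ q : M, TangentSpace (𝓡 2) q, SmoothFieldAt Z p →
      mvfderiv (𝓡 2) (fun q ↦ mvfderiv (𝓡 2) V q (Z q)) p (W p) =
      fderivWithin ℝ (fun y ↦ fderivWithin ℝ (V ∘ (extChartAt (𝓡 2) p).symm) (Set.range (𝓡 2)) y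
        (VectorField.mpullbackWithin 𝓘(ℝ, EuclideanSpace ℝ (Fin 2)) (𝓡 2)
          (extChartAt (𝓡 2) p).symm Z (Set.range (𝓡 2)) y)) (Set.range (𝓡 2)) (extChartAt (𝓡 2) p p)
        (VectorField.mpullbackWithin 𝓘(ℝ, EuclideanSpace ℝ (Fin 2)) (𝓡 2)
          (extChartAt (𝓡 2) p).symm W (Set.range (𝓡 2)) (extChartAt (𝓡 2) p p)) := by
    intro Z W hZ
    have hp : (extChartAt (𝓡 2) p).symm (extChartAt (𝓡 2) p p) = p := by simp
    have h3 := mvfderiv_eq_fderivWithin_chart (X := W) (mem_extChartAt_target p)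
      (V := fun q ↦ mvfderiv (𝓡 2) V q (Z q))
      (by rw [hp]; exact (hZ.mvfderiv_apply hV).mdifferentiableAt (by simp))
    rw [hp] at h3
    rw [h3]
    congr 1
    apply Filter.EventuallyEq.fderivWithin_eq_of_mem _ (by simp)
    have hev : ∀ᶠ q in 𝓝 p, MDifferentiableAt (𝓡 2) 𝓘(ℝ, F) V q := by
      have h4 : ContMDiffAt (𝓡 2) 𝓘(ℝ, F) 1 V p := hV.of_le (by simp)
      have := (contMDiffAt_iff_contMDiffAt_nhds (by simp)).1 h4
      exact this.mono fun q hq ↦ hq.mdifferentiableAt (by simp)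
    have hcont := (continuousAt_extChartAt_symm (I := 𝓡 2) p).eventually (by rw [hp]; exact hev)
    filter_upwards [nhdsWithin_le_nhds hcont,
      nhdsWithin_le_nhds (extChartAt_target_mem_nhds (I := 𝓡 2) p)] with y hy hy'
    exact mvfderiv_eq_fderivWithin_chart (X := Z) hy' hy
  rw [key Y X hY, key X Y hX]
  have hd : ∀ Z : ∀ q : M, TangentSpace (𝓡 2) q, SmoothFieldAt Z p →
      DifferentiableWithinAt ℝ (VectorField.mpullbackWithin 𝓘(ℝ, EuclideanSpace ℝ (Fin 2)) (𝓡 2)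
          (extChartAt (𝓡 2) p).symm Z (Set.range (𝓡 2))) (Set.range (𝓡 2))
          (extChartAt (𝓡 2) p p) := by
    intro Z hZ
    have := MDifferentiableWithinAt.differentiableWithinAt_mpullbackWithin_vectorField
      (s := Set.univ) (x := p) hZ.mdifferentiableAt.mdifferentiableWithinAt
    simpa using this
  have hVc : ContDiffWithinAt ℝ ∞ (V ∘ (extChartAt (𝓡 2) p).symm) (Set.range (𝓡 2))
      (extChartAt (𝓡 2) p p) := by
    exact (contMDiffAt_iff.1 hV).2
  rw [← VectorField.fderivWithin_apply_lieBracket hVc (by simpa using two_le_infty) (𝓡 2).uniqueDiffOn (by simp)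
    (by simp) (hd Y hY) (hd X hX)]
  have hm : MDifferentiableAt (𝓡 2) 𝓘(ℝ, F) V p := hV.mdifferentiableAt (by simp)
  rw [hm.mvfderiv]
  unfold VectorField.mlieBracket
  -- At its own base point the extended chart has the identity as derivative, so the bracket at `p`
  -- is the Euclidean bracket of the pulled-back fields.
  rw [VectorField.mlieBracketWithin_apply, mfderiv_extChartAt_self]
  erw [ContinuousLinearMap.inverse_id]
  simp only [Set.preimage_univ, Set.univ_inter]
  rfl

end Calculus

end ConstantAngle

noncomputable section

namespace ConstantAngle

/-! ### Linear algebra of the forms and of the tangent planes of the space forms. -/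

section Algebra

/-- The sign of the normal direction of `M²(c)`. -/
def normalSign (c : ℝ) : ℝ := if c < 0 then -1 else 1

theorem normalSign_sq (c : ℝ) : normalSign c * normalSign c = 1 := by
  unfold normalSign; split_ifs <;> norm_num

theorem normalSign_mul_abs (c : ℝ) : normalSign c * |c| = c := by
  unfold normalSign
  split_ifs with h
  · rw [abs_of_neg h]; ring
  · rw [abs_of_nonneg (not_lt.1 h)]; ring

theorem form_eq (c : ℝ) (u v : Amb) :
    form c u v = normalSign c * (u 0 * v 0) + u 1 * v 1 + u 2 * v 2 := rfl

theorem form_comm (c : ℝ) (u v : Amb) : form c u v = form c v u := by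
  simp only [form_eq]; ring

@[simp] theorem form_add_left (c : ℝ) (u v w : Amb) :
    form c (u + v) w = form c u w + form c v w := by
  simp only [form_eq, PiLp.add_apply]; ring

@[simp] theorem form_smul_left (c a : ℝ) (u v : Amb) : form c (a • u) v = a * form c u v := by
  simp only [form_eq, PiLp.smul_apply, smul_eq_mul]; ring

@[simp] theorem form_add_right (c : ℝ) (u v w : Amb) :
    form c u (v + w) = form c u v + form c u w := by
  simp only [form_eq, PiLp.add_apply]; ring

@[simp] theorem form_smul_right (c a : ℝ) (u v : Amb) : form c u (a • v) = a * form c u v := by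
  simp only [form_eq, PiLp.smul_apply, smul_eq_mul]; ring

@[simp] theorem form_zero_left (c : ℝ) (u : Amb) : form c 0 u = 0 := by simp [form_eq]

@[simp] theorem form_zero_right (c : ℝ) (u : Amb) : form c u 0 = 0 := by simp [form_eq]

@[simp] theorem form_neg_left (c : ℝ) (u v : Amb) : form c (-u) v = -form c u v := by
  simp only [form_eq, PiLp.neg_apply]; ring

@[simp] theorem form_neg_right (c : ℝ) (u v : Amb) : form c u (-v) = -form c u v := by
  simp only [form_eq, PiLp.neg_apply]; ring

@[simp] theorem form_sub_left (c : ℝ) (u v w : Amb) :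
    form c (u - v) w = form c u w - form c v w := by
  simp only [form_eq, PiLp.sub_apply]; ring

/-- The form as a continuous bilinear map. -/
def formBilin (c : ℝ) : Amb →L[ℝ] Amb →L[ℝ] ℝ :=
  normalSign c • (EuclideanSpace.proj (𝕜 := ℝ) (0 : Fin 3)).smulRight (EuclideanSpace.proj 0) +
    (EuclideanSpace.proj (𝕜 := ℝ) (1 : Fin 3)).smulRight (EuclideanSpace.proj 1) +
    (EuclideanSpace.proj (𝕜 := ℝ) (2 : Fin 3)).smulRight (EuclideanSpace.proj 2)

theorem formBilin_apply (c : ℝ) (u v : Amb) : formBilin c u v = form c u v := by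
  simp [formBilin, form_eq]

/-- The product metric as a continuous bilinear map. -/
def prodBilin (c₁ c₂ : ℝ) : Amb × Amb →L[ℝ] Amb × Amb →L[ℝ] ℝ :=
  (formBilin c₁).bilinearComp (.fst ℝ Amb Amb) (.fst ℝ Amb Amb) +
    (formBilin c₂).bilinearComp (.snd ℝ Amb Amb) (.snd ℝ Amb Amb)

theorem prodBilin_apply (c₁ c₂ : ℝ) (u v : Amb × Amb) :
    prodBilin c₁ c₂ u v = prodMetric c₁ c₂ u v := by
  simp [prodBilin, prodMetric, formBilin_apply]

variable {c₁ c₂ : ℝ}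

theorem prodMetric_comm (u v : Amb × Amb) : prodMetric c₁ c₂ u v = prodMetric c₁ c₂ v u := by
  simp only [prodMetric, form_comm _ u.1, form_comm _ u.2]

@[simp] theorem prodMetric_add_left (u v w : Amb × Amb) :
    prodMetric c₁ c₂ (u + v) w = prodMetric c₁ c₂ u w + prodMetric c₁ c₂ v w := by
  simp [prodMetric]; ring

@[simp] theorem prodMetric_smul_left (a : ℝ) (u w : Amb × Amb) :
    prodMetric c₁ c₂ (a • u) w = a * prodMetric c₁ c₂ u w := by
  simp [prodMetric]; ring

@[simp] theorem prodMetric_add_right (u v w : Amb × Amb) :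
    prodMetric c₁ c₂ u (v + w) = prodMetric c₁ c₂ u v + prodMetric c₁ c₂ u w := by
  simp [prodMetric]; ring

@[simp] theorem prodMetric_smul_right (a : ℝ) (u w : Amb × Amb) :
    prodMetric c₁ c₂ u (a • w) = a * prodMetric c₁ c₂ u w := by
  simp [prodMetric]; ring

@[simp] theorem prodMetric_neg_left (u w : Amb × Amb) :
    prodMetric c₁ c₂ (-u) w = -prodMetric c₁ c₂ u w := by
  simp [prodMetric]; ring

@[simp] theorem prodMetric_neg_right (u w : Amb × Amb) :
    prodMetric c₁ c₂ u (-w) = -prodMetric c₁ c₂ u w := by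
  simp [prodMetric]; ring

@[simp] theorem prodMetric_sub_left (u v w : Amb × Amb) :
    prodMetric c₁ c₂ (u - v) w = prodMetric c₁ c₂ u w - prodMetric c₁ c₂ v w := by
  simp [prodMetric]; ring

@[simp] theorem prodMetric_zero_left (w : Amb × Amb) : prodMetric c₁ c₂ 0 w = 0 := by
  simp [prodMetric]

theorem prodMetric_prodStructure_left (u v : Amb × Amb) :
    prodMetric c₁ c₂ (prodStructure u) v = prodMetric c₁ c₂ u (prodStructure v) := by
  simp [prodMetric, prodStructure]

/-! ### Unit normals and cross products -/

/-- The unit normal of `M²(c)` at `p`. -/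
def unitNormal (c : ℝ) (p : Amb) : Amb :=
  if c = 0 then EuclideanSpace.single 0 1 else √|c| • p

theorem form_unitNormal_self {c : ℝ} {p : Amb} (hp : p ∈ spaceForm c) :
    form c (unitNormal c p) (unitNormal c p) = normalSign c := by
  unfold unitNormal
  by_cases hc : c = 0
  · simp [hc, form_eq]
  · simp only [spaceForm, hc, if_false, Set.mem_ofPred_eq] at hp
    simp only [hc, if_false, form_smul_left, form_smul_right, hp.1]
    rw [← mul_assoc, Real.mul_self_sqrt (abs_nonneg c)]
    nth_rewrite 2 [← normalSign_mul_abs c]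
    have : |c| ≠ 0 := by simpa
    have h2 := normalSign_sq c
    have h3 : normalSign c ≠ 0 := by rintro h; simp [h] at h2
    field_simp
    linarith

theorem exists_unitNormal_eq_smul (c : ℝ) (p : Amb) :
    ∃ k : ℝ, k ≠ 0 ∧ unitNormal c p = k • normalVec c p := by
  unfold unitNormal normalVec
  by_cases hc : c = 0
  · exact ⟨1, one_ne_zero, by simp [hc]⟩
  · exact ⟨√|c|, by simpa [Real.sqrt_eq_zero'] using hc, by simp [hc]⟩

theorem form_normalVec_eq_zero_iff (c : ℝ) (p v : Amb) :
    form c (normalVec c p) v = 0 ↔ form c (unitNormal c p) v = 0 := by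
  obtain ⟨k, hk, h⟩ := exists_unitNormal_eq_smul c p
  simp [h, hk]

/-- The unit normal has square `normalSign c = ±1`, which is its own inverse; this removes the
division and treats all signs of `c` at once. -/
theorem projTangent_eq {c : ℝ} {p : Amb} (hp : p ∈ spaceForm c) (v : Amb) :
    projTangent c p v =
      v - (normalSign c * form c (unitNormal c p) v) • unitNormal c p := by
  obtain ⟨k, hk, h⟩ := exists_unitNormal_eq_smul c p
  have h1 := form_unitNormal_self hp
  rw [h] at h1 ⊢
  simp only [form_smul_left, form_smul_right] at h1 ⊢
  have h2 := normalSign_sq c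
  have h3 : form c (normalVec c p) (normalVec c p) ≠ 0 := by
    intro h0; rw [h0] at h1; simp at h1; simp [← h1] at h2
  rw [projTangent, smul_smul]
  congr 2
  rw [div_eq_iff h3]
  linear_combination (-form c (normalVec c p) v) * h2
    - normalSign c * form c (normalVec c p) v * h1

theorem mem_prodTangent_iff {p v : Amb × Amb} : v ∈ prodTangent c₁ c₂ p ↔
    form c₁ (unitNormal c₁ p.1) v.1 = 0 ∧ form c₂ (unitNormal c₂ p.2) v.2 = 0 := by
  simp [prodTangent, form_normalVec_eq_zero_iff]

/-- For `c < 0` the position vector is timelike, so its orthogonal complement is spacelike: by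
Cauchy–Schwarz `(p₀v₀)² ≤ (p₁² + p₂²)(v₁² + v₂²)`, and `p₁² + p₂² < p₀²`. For `c ≥ 0` the form is
Euclidean. -/
theorem form_self_pos {c : ℝ} {p v : Amb} (hp : p ∈ spaceForm c)
    (h : form c (unitNormal c p) v = 0) (hv : v ≠ 0) : 0 < form c v v := by
  have hne : v 0 ≠ 0 ∨ v 1 ≠ 0 ∨ v 2 ≠ 0 := by
    by_contra! h0
    apply hv; ext i; fin_cases i <;> simp [h0]
  rw [← form_normalVec_eq_zero_iff] at h
  by_cases hc : c < 0
  · simp only [spaceForm, hc.ne, if_false, Set.mem_ofPred_eq] at hp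
    simp only [normalVec, hc.ne, if_false] at h
    obtain ⟨h1, h2⟩ := hp
    specialize h2 hc
    simp only [form_eq, normalSign, hc, if_true] at h h1 ⊢
    have h3 : 1 / c < 0 := by simpa using hc
    have hcs : (p 0 * v 0) ^ 2 ≤ (p 1 ^ 2 + p 2 ^ 2) * (v 1 ^ 2 + v 2 ^ 2) := by
      have : p 0 * v 0 = p 1 * v 1 + p 2 * v 2 := by linarith
      rw [this]
      nlinarith [sq_nonneg (p 1 * v 2 - p 2 * v 1)]
    by_cases hz : v 1 ^ 2 + v 2 ^ 2 = 0
    · have h4 : v 1 = 0 := by nlinarith [sq_nonneg (v 1), sq_nonneg (v 2)]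
      have h5 : v 2 = 0 := by nlinarith [sq_nonneg (v 1), sq_nonneg (v 2)]
      have h6 : v 0 = 0 := by
        rw [h4, h5] at h
        have : p 0 * v 0 = 0 := by linarith
        exact (mul_eq_zero.1 this).resolve_left h2.ne'
      simp [h4, h5, h6] at hne
    · have hz' : 0 < v 1 ^ 2 + v 2 ^ 2 := lt_of_le_of_ne (by positivity) (Ne.symm hz)
      have h7 : p 1 ^ 2 + p 2 ^ 2 < p 0 ^ 2 := by nlinarith
      have h8 : (p 1 ^ 2 + p 2 ^ 2) * (v 1 ^ 2 + v 2 ^ 2) < p 0 ^ 2 * (v 1 ^ 2 + v 2 ^ 2) :=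
        mul_lt_mul_of_pos_right h7 hz'
      have h9 : p 0 ^ 2 * v 0 ^ 2 < p 0 ^ 2 * (v 1 ^ 2 + v 2 ^ 2) := by nlinarith
      have := lt_of_mul_lt_mul_left h9 (sq_nonneg _)
      nlinarith
  · simp only [form_eq, normalSign, hc, if_false]
    rcases hne with h | h | h <;> have := mul_self_pos.2 h <;>
      nlinarith [mul_self_nonneg (v 0), mul_self_nonneg (v 1), mul_self_nonneg (v 2)]

theorem prodMetric_self_pos {p v : Amb × Amb} (hp : p.1 ∈ spaceForm c₁ ∧ p.2 ∈ spaceForm c₂)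
    (h : v ∈ prodTangent c₁ c₂ p) (hv : v ≠ 0) : 0 < prodMetric c₁ c₂ v v := by
  rw [mem_prodTangent_iff] at h
  have h1 : v.1 = 0 ∨ 0 < form c₁ v.1 v.1 := by
    by_cases h0 : v.1 = 0
    exacts [.inl h0, .inr (form_self_pos hp.1 h.1 h0)]
  have h2 : v.2 = 0 ∨ 0 < form c₂ v.2 v.2 := by
    by_cases h0 : v.2 = 0
    exacts [.inl h0, .inr (form_self_pos hp.2 h.2 h0)]
  unfold prodMetric
  rcases h1 with h1 | h1 <;> rcases h2 with h2 | h2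
  · exact absurd (Prod.ext h1 h2) hv
  all_goals simp_all
  positivity

/-- The cross product of the form: `form c (cross c u v) w = det (u, v, w)`. -/
def cross (c : ℝ) (u v : Amb) : Amb :=
  !₂[normalSign c * (u 1 * v 2 - u 2 * v 1), u 2 * v 0 - u 0 * v 2, u 0 * v 1 - u 1 * v 0]

theorem form_cross_left (c : ℝ) (u v : Amb) : form c u (cross c u v) = 0 := by
  simp only [form_eq, cross]
  simp
  linear_combination (u 0 * (u 1 * v 2 - u 2 * v 1)) * normalSign_sq c

theorem form_cross_right (c : ℝ) (u v : Amb) : form c v (cross c u v) = 0 := by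
  simp only [form_eq, cross]
  simp
  linear_combination (v 0 * (u 1 * v 2 - u 2 * v 1)) * normalSign_sq c

/-- Lagrange's identity; it fixes the length of the vector used to build `ξ₁`. -/
theorem form_cross_self (c : ℝ) (u v : Amb) : form c (cross c u v) (cross c u v) =
    normalSign c * (form c u u * form c v v - form c u v ^ 2) := by
  simp only [form_eq, cross]
  simp
  have h := normalSign_sq c
  unfold normalSign at *
  split_ifs <;> ring

theorem contDiff_cross (c : ℝ) : ContDiff ℝ ∞ fun u : Amb × Amb ↦ cross c u.1 u.2 := by
  rw [contDiff_euclidean]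
  intro i
  fin_cases i <;> simp [cross] <;> fun_prop

/-- Parseval's identity for an orthonormal frame of a tangent plane and the unit normal. -/
theorem eq_sum_of_orthonormal {c : ℝ} {N a b : Amb} (hN : form c N N = normalSign c)
    (ha : form c a a = 1) (hb : form c b b = 1) (hNa : form c N a = 0) (hNb : form c N b = 0)
    (hab : form c a b = 0) (w : Amb) :
    w = (normalSign c * form c w N) • N + form c w a • a + form c w b • b := by
  have hs := normalSign_sq c
  have hs0 : normalSign c ≠ 0 := by intro h; simp [h] at hs
  have hli : LinearIndependent ℝ ![N, a, b] := by
    rw [Fintype.linearIndependent_iff]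
    intro g hg
    simp only [Fin.sum_univ_three, Matrix.cons_val_zero, Matrix.cons_val_one,
      Matrix.cons_val_two] at hg
    have h0 := congrArg (form c N) hg
    have h1 := congrArg (form c a) hg
    have h2 := congrArg (form c b) hg
    simp [hN, ha, hb, hNa, hNb, hab, form_comm c a N, form_comm c b N, form_comm c b a] at h0 h1 h2
    intro i; fin_cases i
    · exact h0.resolve_right hs0
    · exact h1
    · exact h2
  let B := basisOfLinearIndependentOfCardEqFinrank hli (by simp)
  have h := B.sum_repr w
  simp only [Fin.sum_univ_three, B, coe_basisOfLinearIndependentOfCardEqFinrank,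
    Matrix.cons_val_zero, Matrix.cons_val_one, Matrix.cons_val_two] at h
  generalize (B.repr w) 0 = x, (B.repr w) 1 = y, (B.repr w) 2 = z at h
  rw [← h]
  simp [hN, ha, hb, hNa, hNb, hab, form_comm c a N, form_comm c b N, form_comm c b a]
  congr 2
  linear_combination (-x) * hs

end Algebra

end ConstantAngle

end

noncomputable section

namespace ConstantAngle

variable {M : Type*} [TopologicalSpace M] [ChartedSpace (EuclideanSpace ℝ (Fin 2)) M]
  {c₁ c₂ : ℝ} {ψ : M → Amb × Amb} {p : M}

/-! ### Product rules for the forms and smoothness of auxiliary maps. -/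

section Derivatives

theorem mvfderiv_prodMetric {V W : M → Amb × Amb}
    (hV : MDifferentiableAt (𝓡 2) 𝓘(ℝ, Amb × Amb) V p)
    (hW : MDifferentiableAt (𝓡 2) 𝓘(ℝ, Amb × Amb) W p) (u : TangentSpace (𝓡 2) p) :
    mvfderiv (𝓡 2) (fun q ↦ prodMetric c₁ c₂ (V q) (W q)) p u =
      prodMetric c₁ c₂ (mvfderiv (𝓡 2) V p u) (W p) +
        prodMetric c₁ c₂ (V p) (mvfderiv (𝓡 2) W p u) := by
  simpa only [prodBilin_apply] using mvfderiv_bilin (prodBilin c₁ c₂) hV hW u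

theorem mvfderiv_form {c : ℝ} {V W : M → Amb}
    (hV : MDifferentiableAt (𝓡 2) 𝓘(ℝ, Amb) V p)
    (hW : MDifferentiableAt (𝓡 2) 𝓘(ℝ, Amb) W p) (u : TangentSpace (𝓡 2) p) :
    mvfderiv (𝓡 2) (fun q ↦ form c (V q) (W q)) p u =
      form c (mvfderiv (𝓡 2) V p u) (W p) + form c (V p) (mvfderiv (𝓡 2) W p u) := by
  simpa only [formBilin_apply] using mvfderiv_bilin (formBilin c) hV hW u

theorem SmoothMapAt.prodMetric {V W : M → Amb × Amb} [IsManifold (𝓡 2) ∞ M]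
    (hV : SmoothMapAt V p) (hW : SmoothMapAt W p) :
    ContMDiffAt (𝓡 2) 𝓘(ℝ, ℝ) ∞ (fun q ↦ prodMetric c₁ c₂ (V q) (W q)) p := by
  have h : ContMDiffAt (𝓡 2) 𝓘(ℝ, Amb × Amb →L[ℝ] ℝ) ∞ (fun q ↦ prodBilin c₁ c₂ (V q)) p :=
    (prodBilin c₁ c₂).contMDiff.contMDiffAt.comp p hV
  simpa only [prodBilin_apply] using h.clm_apply hW

theorem SmoothMapAt.form {c : ℝ} {V W : M → Amb}
    (hV : ContMDiffAt (𝓡 2) 𝓘(ℝ, Amb) ∞ V p) (hW : ContMDiffAt (𝓡 2) 𝓘(ℝ, Amb) ∞ W p) :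
    ContMDiffAt (𝓡 2) 𝓘(ℝ, ℝ) ∞ (fun q ↦ form c (V q) (W q)) p := by
  have h : ContMDiffAt (𝓡 2) 𝓘(ℝ, Amb →L[ℝ] ℝ) ∞ (fun q ↦ formBilin c (V q)) p :=
    (formBilin c).contMDiff.contMDiffAt.comp p hV
  simpa only [formBilin_apply] using h.clm_apply hW

theorem contMDiffAt_unitNormal (c : ℝ) {V : M → Amb}
    (hV : ContMDiffAt (𝓡 2) 𝓘(ℝ, Amb) ∞ V p) :
    ContMDiffAt (𝓡 2) 𝓘(ℝ, Amb) ∞ (fun q ↦ unitNormal c (V q)) p := by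
  by_cases hc : c = 0
  · simp only [unitNormal, hc, if_true]; exact contMDiffAt_const
  · simp only [unitNormal, hc, if_false]
    exact (√|c| • ContinuousLinearMap.id ℝ Amb).contMDiff.contMDiffAt.comp p hV

theorem mvfderiv_unitNormal (c : ℝ) {V : M → Amb}
    (hV : MDifferentiableAt (𝓡 2) 𝓘(ℝ, Amb) V p) (u : TangentSpace (𝓡 2) p) :
    mvfderiv (𝓡 2) (fun q ↦ unitNormal c (V q)) p u = √|c| • mvfderiv (𝓡 2) V p u := by
  by_cases hc : c = 0
  · simp only [unitNormal, hc, if_true]; simp [mvfderiv_const]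
  · simp only [unitNormal, hc, if_false]
    exact mvfderiv_clm_comp (√|c| • ContinuousLinearMap.id ℝ Amb) hV u

theorem mvfderiv_fst {V : M → Amb × Amb}
    (hV : MDifferentiableAt (𝓡 2) 𝓘(ℝ, Amb × Amb) V p) (u : TangentSpace (𝓡 2) p) :
    mvfderiv (𝓡 2) (fun q ↦ (V q).1) p u = (mvfderiv (𝓡 2) V p u).1 :=
  mvfderiv_clm_comp (.fst ℝ Amb Amb) hV u

theorem mvfderiv_snd {V : M → Amb × Amb}
    (hV : MDifferentiableAt (𝓡 2) 𝓘(ℝ, Amb × Amb) V p) (u : TangentSpace (𝓡 2) p) :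
    mvfderiv (𝓡 2) (fun q ↦ (V q).2) p u = (mvfderiv (𝓡 2) V p u).2 :=
  mvfderiv_clm_comp (.snd ℝ Amb Amb) hV u

theorem mdifferentiableAt_fst {V : M → Amb × Amb}
    (hV : MDifferentiableAt (𝓡 2) 𝓘(ℝ, Amb × Amb) V p) :
    MDifferentiableAt (𝓡 2) 𝓘(ℝ, Amb) (fun q ↦ (V q).1) p :=
  ((ContinuousLinearMap.fst ℝ Amb Amb).mdifferentiableAt (x := V p)).comp p hV

theorem mdifferentiableAt_snd {V : M → Amb × Amb}
    (hV : MDifferentiableAt (𝓡 2) 𝓘(ℝ, Amb × Amb) V p) :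
    MDifferentiableAt (𝓡 2) 𝓘(ℝ, Amb) (fun q ↦ (V q).2) p :=
  ((ContinuousLinearMap.snd ℝ Amb Amb).mdifferentiableAt (x := V p)).comp p hV

theorem contMDiffAt_fst {V : M → Amb × Amb}
    (hV : ContMDiffAt (𝓡 2) 𝓘(ℝ, Amb × Amb) ∞ V p) :
    ContMDiffAt (𝓡 2) 𝓘(ℝ, Amb) ∞ (fun q ↦ (V q).1) p :=
  (ContinuousLinearMap.fst ℝ Amb Amb).contMDiff.contMDiffAt.comp p hV

theorem contMDiffAt_snd {V : M → Amb × Amb}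
    (hV : ContMDiffAt (𝓡 2) 𝓘(ℝ, Amb × Amb) ∞ V p) :
    ContMDiffAt (𝓡 2) 𝓘(ℝ, Amb) ∞ (fun q ↦ (V q).2) p :=
  (ContinuousLinearMap.snd ℝ Amb Amb).contMDiff.contMDiffAt.comp p hV

theorem contMDiffAt_pair {V W : M → Amb}
    (hV : ContMDiffAt (𝓡 2) 𝓘(ℝ, Amb) ∞ V p) (hW : ContMDiffAt (𝓡 2) 𝓘(ℝ, Amb) ∞ W p) :
    ContMDiffAt (𝓡 2) 𝓘(ℝ, Amb × Amb) ∞ (fun q ↦ (V q, W q)) p := hV.prodMk_space hW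

/-- If a function is locally constant then its derivative vanishes. -/
theorem mvfderiv_eq_zero_of_eventually_const {F : Type*} [NormedAddCommGroup F] [NormedSpace ℝ F]
    {V : M → F} {a : F} (h : ∀ᶠ q in 𝓝 p, V q = a) : mvfderiv (𝓡 2) V p = 0 := by
  rw [mvfderiv_congr (W := fun _ ↦ a) h, mvfderiv_const]

end Derivatives

/-! ### The induced metric and the tangential projection. -/

section TangentialPart

instance (p : M) : FiniteDimensional ℝ (TangentSpace (𝓡 2) p) :=
  inferInstanceAs (FiniteDimensional ℝ (EuclideanSpace ℝ (Fin 2)))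

theorem finrank_tangentSpace (p : M) : Module.finrank ℝ (TangentSpace (𝓡 2) p) = 2 :=
  finrank_euclideanSpace_fin (𝕜 := ℝ) (n := 2)

theorem indMetric_comm (u v : TangentSpace (𝓡 2) p) :
    indMetric c₁ c₂ ψ p u v = indMetric c₁ c₂ ψ p v u := prodMetric_comm _ _

@[simp] theorem indMetric_add_left (u v w : TangentSpace (𝓡 2) p) :
    indMetric c₁ c₂ ψ p (u + v) w = indMetric c₁ c₂ ψ p u w + indMetric c₁ c₂ ψ p v w := by
  simp [indMetric]

@[simp] theorem indMetric_sub_left (u v w : TangentSpace (𝓡 2) p) :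
    indMetric c₁ c₂ ψ p (u - v) w = indMetric c₁ c₂ ψ p u w - indMetric c₁ c₂ ψ p v w := by
  simp [indMetric]

@[simp] theorem indMetric_add_right (u v w : TangentSpace (𝓡 2) p) :
    indMetric c₁ c₂ ψ p u (v + w) = indMetric c₁ c₂ ψ p u v + indMetric c₁ c₂ ψ p u w := by
  simp [indMetric]

@[simp] theorem indMetric_smul_left (a : ℝ) (u w : TangentSpace (𝓡 2) p) :
    indMetric c₁ c₂ ψ p (a • u) w = a * indMetric c₁ c₂ ψ p u w := by
  simp [indMetric]

@[simp] theorem indMetric_smul_right (a : ℝ) (u w : TangentSpace (𝓡 2) p) :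
    indMetric c₁ c₂ ψ p u (a • w) = a * indMetric c₁ c₂ ψ p u w := by
  simp [indMetric]

/-- Differentiate the defining equation of `M²(c)`, which is linear for `c = 0` and quadratic
otherwise. -/
theorem form_unitNormal_mvfderiv {c : ℝ} {V : M → Amb}
    (hV : MDifferentiableAt (𝓡 2) 𝓘(ℝ, Amb) V p) (h : ∀ q, V q ∈ spaceForm c)
    (u : TangentSpace (𝓡 2) p) : form c (unitNormal c (V p)) (mvfderiv (𝓡 2) V p u) = 0 := by
  rw [← form_normalVec_eq_zero_iff]
  by_cases hc : c = 0
  · subst hc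
    have h1 := mvfderiv_eq_zero_of_eventually_const (p := p) (a := (0 : ℝ)) (.of_forall fun q ↦ by
      simpa [spaceForm] using h q)
    have h2 := mvfderiv_clm_comp (EuclideanSpace.proj (𝕜 := ℝ) (0 : Fin 3)) hV u
    have h3 : (mvfderiv (𝓡 2) V p u) 0 = 0 := by
      simpa [h1] using h2.symm
    simp [form_eq, normalVec, h3]
  · have h1 := mvfderiv_eq_zero_of_eventually_const (p := p)
      (V := fun q ↦ form c (V q) (V q)) (a := 1 / c) (.of_forall fun q ↦ by
      have := h q
      simp only [spaceForm, hc, if_false] at this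
      exact this.1)
    have h2 := mvfderiv_form (c := c) hV hV u
    rw [h1, form_comm c _ (V p)] at h2
    simp only [normalVec, hc, if_false]
    simp at h2
    linarith

variable (hψ : IsImmersedSurface c₁ c₂ ψ)

include hψ

theorem IsImmersedSurface.smoothMapAt [IsManifold (𝓡 2) ∞ M] (p : M) : SmoothMapAt ψ p :=
  hψ.smooth.contMDiffAt

theorem IsImmersedSurface.mdifferentiableAt (p : M) :
    MDifferentiableAt (𝓡 2) 𝓘(ℝ, Amb × Amb) ψ p :=
  hψ.smooth.contMDiffAt.mdifferentiableAt (by simp)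

theorem IsImmersedSurface.mvfderiv_mem (p : M) (u : TangentSpace (𝓡 2) p) :
    mvfderiv (𝓡 2) ψ p u ∈ prodTangent c₁ c₂ (ψ p) := by
  have h := hψ.mdifferentiableAt p
  rw [mem_prodTangent_iff, ← mvfderiv_fst h, ← mvfderiv_snd h]
  exact ⟨form_unitNormal_mvfderiv (mdifferentiableAt_fst h) (fun q ↦ (hψ.mem q).1) u,
    form_unitNormal_mvfderiv (mdifferentiableAt_snd h) (fun q ↦ (hψ.mem q).2) u⟩

theorem IsImmersedSurface.indMetric_self_pos {u : TangentSpace (𝓡 2) p} (hu : u ≠ 0) :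
    0 < indMetric c₁ c₂ ψ p u u := by
  refine prodMetric_self_pos (hψ.mem p) (hψ.mvfderiv_mem p u) fun h ↦ hu ?_
  exact hψ.injective p (by rw [h, map_zero])

theorem IsImmersedSurface.eq_of_indMetric {u v : TangentSpace (𝓡 2) p}
    (h : ∀ w, indMetric c₁ c₂ ψ p u w = indMetric c₁ c₂ ψ p v w) : u = v := by
  by_contra hne
  have := hψ.indMetric_self_pos (sub_ne_zero.2 hne)
  rw [indMetric_sub_left, h, sub_self] at this
  exact this.false

/-- The induced metric is definite, so `u ↦ g(u, ·)` is an injective map into the dual, hence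
surjective by dimension. This makes the choice in `tanPart` meaningful. -/
theorem IsImmersedSurface.exists_tanPart (p : M) (v : Amb × Amb) :
    ∃ u : TangentSpace (𝓡 2) p, ∀ w : TangentSpace (𝓡 2) p,
      indMetric c₁ c₂ ψ p u w = prodMetric c₁ c₂ v (mvfderiv (𝓡 2) ψ p w) := by
  let B : TangentSpace (𝓡 2) p →ₗ[ℝ] Module.Dual ℝ (TangentSpace (𝓡 2) p) :=
    LinearMap.mk₂ ℝ (indMetric c₁ c₂ ψ p) (by simp) (by simp) (by simp) (by simp)
  have hinj : Function.Injective B := fun u v h ↦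
    hψ.eq_of_indMetric fun w ↦ LinearMap.congr_fun h w
  have hsurj : Function.Surjective B :=
    (LinearMap.injective_iff_surjective_of_finrank_eq_finrank
      (Subspace.dual_finrank_eq (K := ℝ)).symm).1 hinj
  obtain ⟨u, hu⟩ := hsurj ((prodBilin c₁ c₂ v).comp (mvfderiv (𝓡 2) ψ p)).toLinearMap
  refine ⟨u, fun w ↦ ?_⟩
  have := LinearMap.congr_fun hu w
  simpa [prodBilin_apply, B] using this

theorem IsImmersedSurface.indMetric_tanPart (v : Amb × Amb) (w : TangentSpace (𝓡 2) p) :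
    indMetric c₁ c₂ ψ p (tanPart c₁ c₂ ψ p v) w = prodMetric c₁ c₂ v (mvfderiv (𝓡 2) ψ p w) :=
  Classical.epsilon_spec (hψ.exists_tanPart p v) w

theorem IsImmersedSurface.tanPart_eq_of_forall {v : Amb × Amb} {u : TangentSpace (𝓡 2) p}
    (h : ∀ w, indMetric c₁ c₂ ψ p u w = prodMetric c₁ c₂ v (mvfderiv (𝓡 2) ψ p w)) :
    tanPart c₁ c₂ ψ p v = u :=
  hψ.eq_of_indMetric fun w ↦ by rw [hψ.indMetric_tanPart, h]

omit hψ in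
theorem TanOrthonormal.eq_sum {u v : TangentSpace (𝓡 2) p} (h : TanOrthonormal c₁ c₂ ψ p u v)
    (w : TangentSpace (𝓡 2) p) :
    w = indMetric c₁ c₂ ψ p w u • u + indMetric c₁ c₂ ψ p w v • v := by
  obtain ⟨hu, hv, huv⟩ := h
  have hvu : indMetric c₁ c₂ ψ p v u = 0 := by rw [indMetric_comm, huv]
  have hli : LinearIndependent ℝ ![u, v] := by
    rw [LinearIndependent.pair_iff]
    intro s t hst
    have h0 := congrArg (fun x ↦ indMetric c₁ c₂ ψ p x u) hst
    have h1 := congrArg (fun x ↦ indMetric c₁ c₂ ψ p x v) hst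
    have hz : ∀ x, indMetric c₁ c₂ ψ p 0 x = 0 := fun x ↦ by simp [indMetric]
    simp [hu, hv, huv, hvu, hz] at h0 h1
    exact ⟨h0, h1⟩
  let B := basisOfLinearIndependentOfCardEqFinrank hli (by simp [finrank_tangentSpace])
  have h := B.sum_repr w
  simp only [Fin.sum_univ_two, B, coe_basisOfLinearIndependentOfCardEqFinrank,
    Matrix.cons_val_zero, Matrix.cons_val_one] at h
  generalize (B.repr w) 0 = x, (B.repr w) 1 = y at h
  rw [← h]
  simp [hu, hv, huv, hvu]

theorem IsImmersedSurface.tanPart_eq {u v : TangentSpace (𝓡 2) p}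
    (h : TanOrthonormal c₁ c₂ ψ p u v) (w : Amb × Amb) :
    tanPart c₁ c₂ ψ p w = prodMetric c₁ c₂ w (mvfderiv (𝓡 2) ψ p u) • u +
      prodMetric c₁ c₂ w (mvfderiv (𝓡 2) ψ p v) • v := by
  rw [h.eq_sum (tanPart c₁ c₂ ψ p w), hψ.indMetric_tanPart, hψ.indMetric_tanPart]

theorem IsImmersedSurface.tanPart_mvfderiv (u : TangentSpace (𝓡 2) p) :
    tanPart c₁ c₂ ψ p (mvfderiv (𝓡 2) ψ p u) = u :=
  hψ.tanPart_eq_of_forall fun _ ↦ rfl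

theorem IsImmersedSurface.tanPart_add (v w : Amb × Amb) :
    tanPart c₁ c₂ ψ p (v + w) = tanPart c₁ c₂ ψ p v + tanPart c₁ c₂ ψ p w :=
  hψ.tanPart_eq_of_forall fun _ ↦ by simp [hψ.indMetric_tanPart]

theorem IsImmersedSurface.tanPart_smul (a : ℝ) (v : Amb × Amb) :
    tanPart c₁ c₂ ψ p (a • v) = a • tanPart c₁ c₂ ψ p v :=
  hψ.tanPart_eq_of_forall fun _ ↦ by simp [hψ.indMetric_tanPart]

end TangentialPart

/-! ### Smooth local frames and smoothness of the tangential projection. -/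

section SmoothTangentialPart

variable [IsManifold (𝓡 2) ∞ M]

theorem SmoothFieldAt.add {X Y : ∀ q : M, TangentSpace (𝓡 2) q} (hX : SmoothFieldAt X p)
    (hY : SmoothFieldAt Y p) : SmoothFieldAt (fun q ↦ X q + Y q) p :=
  ContMDiffAt.add_section hX hY

theorem SmoothFieldAt.smul {X : ∀ q : M, TangentSpace (𝓡 2) q} {f : M → ℝ}
    (hf : ContMDiffAt (𝓡 2) 𝓘(ℝ, ℝ) ∞ f p) (hX : SmoothFieldAt X p) :
    SmoothFieldAt (fun q ↦ f q • X q) p :=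
  ContMDiffAt.smul_section hf hX

theorem SmoothFieldAt.congr {X Y : ∀ q : M, TangentSpace (𝓡 2) q} (hX : SmoothFieldAt X p)
    (h : ∀ᶠ q in 𝓝 p, Y q = X q) : SmoothFieldAt Y p :=
  ContMDiffAt.congr_of_eventuallyEq hX (h.mono fun q hq ↦ by simp only [hq])

/-- A smooth frame on a neighbourhood of a given point. -/
theorem exists_smooth_frame (p : M) : ∃ U : Set M, IsOpen U ∧ p ∈ U ∧
    ∃ s : Fin 2 → ∀ q : M, TangentSpace (𝓡 2) q, (∀ i, ∀ q ∈ U, SmoothFieldAt (s i) q) ∧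
      ∀ q ∈ U, ∀ w : TangentSpace (𝓡 2) q, ∃ a b : ℝ, w = a • s 0 q + b • s 1 q := by
  let e := trivializationAt (EuclideanSpace ℝ (Fin 2)) (TangentSpace (𝓡 2) : M → Type _) p
  let b := (EuclideanSpace.basisFun (Fin 2) ℝ).toBasis
  refine ⟨e.baseSet, e.open_baseSet, FiberBundle.mem_baseSet_trivializationAt' p,
    e.localFrame b, fun i q hq ↦ ?_, fun q hq w ↦ ?_⟩
  · exact contMDiffAt_localFrame_of_mem ∞ e b i hq
  · refine ⟨(e.basisAt b hq).repr w 0, (e.basisAt b hq).repr w 1, ?_⟩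
    have := (e.basisAt b hq).sum_repr w
    rw [Fin.sum_univ_two] at this
    simp [hq, this]

/-- Every tangent vector extends to a vector field that is smooth near the base point. -/
theorem exists_smooth_extension (p : M) (w : TangentSpace (𝓡 2) p) : ∃ U : Set M, IsOpen U ∧
    p ∈ U ∧ ∃ X : ∀ q : M, TangentSpace (𝓡 2) q, (∀ q ∈ U, SmoothFieldAt X q) ∧ X p = w := by
  obtain ⟨U, hU, hp, s, hs, hspan⟩ := exists_smooth_frame p
  obtain ⟨a, b, rfl⟩ := hspan p hp w
  exact ⟨U, hU, hp, fun q ↦ a • s 0 q + b • s 1 q, fun q hq ↦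
    ((hs 0 q hq).smul contMDiffAt_const).add ((hs 1 q hq).smul contMDiffAt_const), rfl⟩

theorem SmoothFieldAt.smoothMapAt {X : ∀ q : M, TangentSpace (𝓡 2) q} {V : M → Amb × Amb}
    (hX : SmoothFieldAt X p) (hV : SmoothMapAt V p) :
    SmoothMapAt (fun q ↦ mvfderiv (𝓡 2) V q (X q)) p := hX.mvfderiv_apply hV

/-- The tangential part of a smooth map along the surface is a smooth vector field. -/
theorem IsImmersedSurface.smoothFieldAt_tanPart (hψ : IsImmersedSurface c₁ c₂ ψ)
    {V : M → Amb × Amb} (hV : SmoothMapAt V p) :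
    SmoothFieldAt (fun q ↦ tanPart c₁ c₂ ψ q (V q)) p := by
  obtain ⟨U, hU, hp, s, hs, hspan⟩ := exists_smooth_frame p
  let E (i : Fin 2) (q : M) : Amb × Amb := mvfderiv (𝓡 2) ψ q (s i q)
  let g (i j : Fin 2) (q : M) : ℝ := prodMetric c₁ c₂ (E i q) (E j q)
  let r (i : Fin 2) (q : M) : ℝ := prodMetric c₁ c₂ (V q) (E i q)
  let d (q : M) : ℝ := g 0 0 q * g 1 1 q - g 0 1 q * g 0 1 q
  have hE i : SmoothMapAt (E i) p := (hs i p hp).smoothMapAt (hψ.smoothMapAt p)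
  have hg i j : ContMDiffAt (𝓡 2) 𝓘(ℝ, ℝ) ∞ (g i j) p := (hE i).prodMetric (hE j)
  have hr i : ContMDiffAt (𝓡 2) 𝓘(ℝ, ℝ) ∞ (r i) p := hV.prodMetric (hE i)
  have hd : ContMDiffAt (𝓡 2) 𝓘(ℝ, ℝ) ∞ d p :=
    ((hg 0 0).mul (hg 1 1)).sub ((hg 0 1).mul (hg 0 1))
  -- Two vectors spanning a two-dimensional space are independent; hence the Gram determinant `d` is
  -- nonzero.
  have hind : ∀ q ∈ U, ∀ a b : ℝ, a • s 0 q + b • s 1 q = 0 → a = 0 ∧ b = 0 := by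
    intro q hq
    have hspan' : ⊤ ≤ Submodule.span ℝ (Set.range ![s 0 q, s 1 q]) := by
      intro w _
      obtain ⟨a, b, rfl⟩ := hspan q hq w
      exact Submodule.add_mem _ (Submodule.smul_mem _ _ (Submodule.subset_span ⟨0, rfl⟩))
        (Submodule.smul_mem _ _ (Submodule.subset_span ⟨1, rfl⟩))
    have := linearIndependent_of_top_le_span_of_card_eq_finrank hspan'
      (by simp [finrank_tangentSpace])
    exact LinearIndependent.pair_iff.1 this
  have hdpos : ∀ q ∈ U, d q ≠ 0 := by
    intro q hq h0
    have h1 : s 0 q ≠ 0 := fun h ↦ by simpa using hind q hq 1 0 (by simp [h])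
    have h2 : 0 < g 0 0 q := hψ.indMetric_self_pos h1
    -- This is the Gram–Schmidt vector, whose squared length is `g 0 0 q * d q`.
    have h3 : (-g 0 1 q) • s 0 q + g 0 0 q • s 1 q ≠ 0 := fun h ↦
      h2.ne' (hind q hq _ _ h).2
    have h4 := hψ.indMetric_self_pos h3
    have h5 : indMetric c₁ c₂ ψ q (s 1 q) (s 0 q) = g 0 1 q := indMetric_comm _ _
    simp only [indMetric_add_left, indMetric_add_right, indMetric_smul_left,
      indMetric_smul_right, h5] at h4
    change 0 < -g 0 1 q * (-g 0 1 q * g 0 0 q + g 0 0 q * g 0 1 q) +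
      g 0 0 q * (-g 0 1 q * g 0 1 q + g 0 0 q * g 1 1 q) at h4
    have : g 0 0 q * d q = 0 := by rw [h0, mul_zero]
    simp only [d] at this
    linarith
  -- The coefficients are Cramer's rule for the Gram system of the frame.
  have hsm : SmoothFieldAt (fun q ↦ ((r 0 q * g 1 1 q - r 1 q * g 0 1 q) * (d q)⁻¹) • s 0 q +
      ((r 1 q * g 0 0 q - r 0 q * g 0 1 q) * (d q)⁻¹) • s 1 q) p := by
    have hdi : ContMDiffAt (𝓡 2) 𝓘(ℝ, ℝ) ∞ (fun q ↦ (d q)⁻¹) p := hd.inv₀ (hdpos p hp)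
    exact ((hs 0 p hp).smul (((((hr 0).mul (hg 1 1)).sub ((hr 1).mul (hg 0 1)))).mul hdi)).add
      ((hs 1 p hp).smul (((((hr 1).mul (hg 0 0)).sub ((hr 0).mul (hg 0 1)))).mul hdi))
  refine hsm.congr ?_
  filter_upwards [hU.mem_nhds hp] with q hq
  apply hψ.tanPart_eq_of_forall
  intro w
  obtain ⟨a, b, rfl⟩ := hspan q hq w
  have h5 : indMetric c₁ c₂ ψ q (s 1 q) (s 0 q) = g 0 1 q := indMetric_comm _ _
  simp only [indMetric_add_left, indMetric_add_right, indMetric_smul_left,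
      indMetric_smul_right, h5, map_add, map_smul, prodMetric_add_right, prodMetric_smul_right]
  change a * (_ * g 0 0 q + _ * g 0 1 q) + b * (_ * g 0 1 q + _ * g 1 1 q) =
    a * r 0 q + b * r 1 q
  have := hdpos q hq
  field_simp
  simp only [d]
  ring

end SmoothTangentialPart

end ConstantAngle

end

noncomputable section

namespace ConstantAngle

variable {M : Type*} [TopologicalSpace M] [ChartedSpace (EuclideanSpace ℝ (Fin 2)) M]
  {c₁ c₂ : ℝ} {ψ : M → Amb × Amb} {p : M}

/-! ### Connections of the surface as projections of the flat derivative. -/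

section Connections

theorem SmoothMapAt.mdifferentiableAt [IsManifold (𝓡 2) ∞ M] {V : M → Amb × Amb}
    (hV : SmoothMapAt V p) : MDifferentiableAt (𝓡 2) 𝓘(ℝ, Amb × Amb) V p :=
  ContMDiffAt.mdifferentiableAt hV (by simp)

theorem IsImmersedSurface.ambConn_mem (hψ : IsImmersedSurface c₁ c₂ ψ) (V : M → Amb × Amb) (p : M)
    (u : TangentSpace (𝓡 2) p) : ambConn c₁ c₂ ψ V p u ∈ prodTangent c₁ c₂ (ψ p) := by
  have key : ∀ {c : ℝ} {x : Amb}, x ∈ spaceForm c → ∀ v,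
      form c (unitNormal c x) (projTangent c x v) = 0 := by
    intro c x hx v
    have hs := normalSign_sq c
    rw [projTangent_eq hx, form_comm, form_sub_left, form_smul_left, form_unitNormal_self hx,
      form_comm c v]
    linear_combination (-form c (unitNormal c x) v) * hs
  rw [mem_prodTangent_iff]
  exact ⟨key (hψ.mem p).1 _, key (hψ.mem p).2 _⟩

/-- Projecting to the product only removes multiples of the two unit normals, which are orthogonal
to `w`. Later computations can therefore use the flat derivative. -/
theorem IsImmersedSurface.prodMetric_ambConn (hψ : IsImmersedSurface c₁ c₂ ψ) (V : M → Amb × Amb)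
    (u : TangentSpace (𝓡 2) p) {w : Amb × Amb} (hw : w ∈ prodTangent c₁ c₂ (ψ p)) :
    prodMetric c₁ c₂ (ambConn c₁ c₂ ψ V p u) w =
      prodMetric c₁ c₂ (mvfderiv (𝓡 2) V p u) w := by
  rw [mem_prodTangent_iff] at hw
  simp [prodMetric, ambConn, projTangent_eq (hψ.mem p).1, projTangent_eq (hψ.mem p).2, hw.1, hw.2]

theorem IsImmersedSurface.tanPart_ambConn (hψ : IsImmersedSurface c₁ c₂ ψ) (V : M → Amb × Amb)
    (u : TangentSpace (𝓡 2) p) :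
    tanPart c₁ c₂ ψ p (ambConn c₁ c₂ ψ V p u) = tanPart c₁ c₂ ψ p (mvfderiv (𝓡 2) V p u) :=
  hψ.tanPart_eq_of_forall fun w ↦ by
    rw [hψ.indMetric_tanPart, hψ.prodMetric_ambConn _ _ (hψ.mvfderiv_mem p w)]

theorem IsImmersedSurface.shapeOp_eq (hψ : IsImmersedSurface c₁ c₂ ψ) (ξ : M → Amb × Amb)
    (u : TangentSpace (𝓡 2) p) :
    shapeOp c₁ c₂ ψ ξ p u = -tanPart c₁ c₂ ψ p (mvfderiv (𝓡 2) ξ p u) := by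
  rw [shapeOp, hψ.tanPart_ambConn]

theorem IsImmersedSurface.prodMetric_normalConn (hψ : IsImmersedSurface c₁ c₂ ψ)
    (ξ : M → Amb × Amb) (u : TangentSpace (𝓡 2) p) {w : Amb × Amb}
    (hw : IsNormal c₁ c₂ ψ p w) :
    prodMetric c₁ c₂ (normalConn c₁ c₂ ψ ξ p u) w =
      prodMetric c₁ c₂ (mvfderiv (𝓡 2) ξ p u) w := by
  rw [normalConn, norPart, prodMetric_sub_left, hψ.prodMetric_ambConn _ _ hw.1,
    prodMetric_comm (mvfderiv (𝓡 2) ψ p _), hw.2, sub_zero]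

theorem prodTangent_sub {x v w : Amb × Amb} (hv : v ∈ prodTangent c₁ c₂ x)
    (hw : w ∈ prodTangent c₁ c₂ x) : v - w ∈ prodTangent c₁ c₂ x := by
  simp only [mem_prodTangent_iff, Prod.fst_sub, Prod.snd_sub, form_comm _ (unitNormal _ _),
    form_sub_left] at *
  simp [hv.1, hv.2, hw.1, hw.2]

theorem IsImmersedSurface.isNormal_norPart (hψ : IsImmersedSurface c₁ c₂ ψ) {v : Amb × Amb}
    (hv : v ∈ prodTangent c₁ c₂ (ψ p)) : IsNormal c₁ c₂ ψ p (norPart c₁ c₂ ψ p v) := by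
  refine ⟨prodTangent_sub hv (hψ.mvfderiv_mem p _), fun w ↦ ?_⟩
  rw [norPart, prodMetric_sub_left, sub_eq_zero]
  exact (hψ.indMetric_tanPart v w).symm

theorem IsImmersedSurface.isNormal_normalConn (hψ : IsImmersedSurface c₁ c₂ ψ)
    (ξ : M → Amb × Amb) (p : M) (u : TangentSpace (𝓡 2) p) :
    IsNormal c₁ c₂ ψ p (normalConn c₁ c₂ ψ ξ p u) :=
  hψ.isNormal_norPart (hψ.ambConn_mem ξ p u)

variable [IsManifold (𝓡 2) ∞ M]

/-- The Levi-Civita connection of the induced metric is the tangential part of the flat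
derivative. -/
theorem IsImmersedSurface.leviCivita_eq (hψ : IsImmersedSurface c₁ c₂ ψ)
    {X Y : ∀ q : M, TangentSpace (𝓡 2) q} (hX : SmoothFieldAt X p) (hY : SmoothFieldAt Y p) :
    leviCivita c₁ c₂ ψ X Y p =
      tanPart c₁ c₂ ψ p (mvfderiv (𝓡 2) (fun q ↦ mvfderiv (𝓡 2) ψ q (Y q)) p (X p)) := by
  set u₀ := tanPart c₁ c₂ ψ p (mvfderiv (𝓡 2) (fun q ↦ mvfderiv (𝓡 2) ψ q (Y q)) p (X p))
  -- With `g` written through `dψ` and brackets as commutators of second derivatives of `ψ`,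
  -- everything in the Koszul formula cancels except twice `⟨D_X dψ Y, dψ Z⟩`.
  have hsat : ∀ Z : ∀ q : M, TangentSpace (𝓡 2) q, SmoothFieldAt Z p →
    2 * indMetric c₁ c₂ ψ p u₀ (Z p) =
      mvfderiv (𝓡 2) (fun q ↦ indMetric c₁ c₂ ψ q (Y q) (Z q)) p (X p)
      + mvfderiv (𝓡 2) (fun q ↦ indMetric c₁ c₂ ψ q (X q) (Z q)) p (Y p)
      - mvfderiv (𝓡 2) (fun q ↦ indMetric c₁ c₂ ψ q (X q) (Y q)) p (Z p)
      + indMetric c₁ c₂ ψ p (VectorField.mlieBracket (𝓡 2) X Y p) (Z p)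
      - indMetric c₁ c₂ ψ p (VectorField.mlieBracket (𝓡 2) X Z p) (Y p)
      - indMetric c₁ c₂ ψ p (VectorField.mlieBracket (𝓡 2) Y Z p) (X p) := by
    intro Z hZ
    have hs := hψ.smoothMapAt p
    have dX := (hX.smoothMapAt hs).mdifferentiableAt
    have dY := (hY.smoothMapAt hs).mdifferentiableAt
    have dZ := (hZ.smoothMapAt hs).mdifferentiableAt
    rw [hψ.indMetric_tanPart]
    simp only [indMetric]
    rw [mvfderiv_prodMetric dY dZ, mvfderiv_prodMetric dX dZ, mvfderiv_prodMetric dX dY,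
      mvfderiv_commutator hs hX hY, mvfderiv_commutator hs hX hZ, mvfderiv_commutator hs hY hZ]
    simp only [prodMetric_sub_left]
    rw [prodMetric_comm (mvfderiv (𝓡 2) ψ p (Y p)), prodMetric_comm (mvfderiv (𝓡 2) ψ p (X p)),
      prodMetric_comm (mvfderiv (𝓡 2) ψ p (X p))]
    ring
  have heps := Classical.epsilon_spec (p := fun u ↦ ∀ Z : ∀ q : M, TangentSpace (𝓡 2) q,
    SmoothFieldAt Z p → 2 * indMetric c₁ c₂ ψ p u (Z p) =
      mvfderiv (𝓡 2) (fun q ↦ indMetric c₁ c₂ ψ q (Y q) (Z q)) p (X p)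
      + mvfderiv (𝓡 2) (fun q ↦ indMetric c₁ c₂ ψ q (X q) (Z q)) p (Y p)
      - mvfderiv (𝓡 2) (fun q ↦ indMetric c₁ c₂ ψ q (X q) (Y q)) p (Z p)
      + indMetric c₁ c₂ ψ p (VectorField.mlieBracket (𝓡 2) X Y p) (Z p)
      - indMetric c₁ c₂ ψ p (VectorField.mlieBracket (𝓡 2) X Z p) (Y p)
      - indMetric c₁ c₂ ψ p (VectorField.mlieBracket (𝓡 2) Y Z p) (X p)) ⟨u₀, hsat⟩
  -- The Koszul condition determines the vector, since each tangent vector is the value of a smooth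
  -- local field.
  refine hψ.eq_of_indMetric fun w ↦ ?_
  obtain ⟨U, -, hpU, Z, hZ, rfl⟩ := exists_smooth_extension p w
  have h1 := heps Z (hZ p hpU)
  rw [← hsat Z (hZ p hpU)] at h1
  exact mul_left_cancel₀ two_ne_zero h1

theorem IsImmersedSurface.smoothFieldAt_leviCivita (hψ : IsImmersedSurface c₁ c₂ ψ)
    {X Y : ∀ q : M, TangentSpace (𝓡 2) q}
    (h : ∀ᶠ q in 𝓝 p, SmoothFieldAt X q ∧ SmoothFieldAt Y q) :
    SmoothFieldAt (leviCivita c₁ c₂ ψ X Y) p := by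
  obtain ⟨hX, hY⟩ := h.self_of_nhds
  refine (hψ.smoothFieldAt_tanPart
    (hX.smoothMapAt (hY.smoothMapAt (hψ.smoothMapAt p)))).congr ?_
  filter_upwards [h] with q hq
  exact hψ.leviCivita_eq hq.1 hq.2

end Connections

/-! ### Curvature of a plane bundle inside the flat ambient space. -/

section PlaneBundle

/-- The projection to the span of the orthonormal pair `s₁, s₂`. -/
def pairProj (c₁ c₂ : ℝ) (s₁ s₂ v : Amb × Amb) : Amb × Amb :=
  prodMetric c₁ c₂ v s₁ • s₁ + prodMetric c₁ c₂ v s₂ • s₂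

variable [IsManifold (𝓡 2) ∞ M] {s₁ s₂ V : M → Amb × Amb}

theorem prodMetric_mvfderiv_of_orthonormal (h₁ : SmoothMapAt s₁ p) (h₂ : SmoothMapAt s₂ p)
    (ho : ∀ᶠ q in 𝓝 p, AmbOrthonormal c₁ c₂ (s₁ q) (s₂ q)) (u : TangentSpace (𝓡 2) p) :
    prodMetric c₁ c₂ (mvfderiv (𝓡 2) s₁ p u) (s₁ p) = 0 ∧
    prodMetric c₁ c₂ (mvfderiv (𝓡 2) s₂ p u) (s₂ p) = 0 ∧
    prodMetric c₁ c₂ (mvfderiv (𝓡 2) s₂ p u) (s₁ p) =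
      -prodMetric c₁ c₂ (mvfderiv (𝓡 2) s₁ p u) (s₂ p) := by
  have d₁ := h₁.mdifferentiableAt
  have d₂ := h₂.mdifferentiableAt
  have e1 := mvfderiv_prodMetric (c₁ := c₁) (c₂ := c₂) d₁ d₁ u
  have e2 := mvfderiv_prodMetric (c₁ := c₁) (c₂ := c₂) d₂ d₂ u
  have e3 := mvfderiv_prodMetric (c₁ := c₁) (c₂ := c₂) d₁ d₂ u
  rw [mvfderiv_eq_zero_of_eventually_const (ho.mono fun q hq ↦ hq.1),
    prodMetric_comm (s₁ p)] at e1
  rw [mvfderiv_eq_zero_of_eventually_const (ho.mono fun q hq ↦ hq.2.1),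
    prodMetric_comm (s₂ p)] at e2
  rw [mvfderiv_eq_zero_of_eventually_const (ho.mono fun q hq ↦ hq.2.2),
    prodMetric_comm (s₁ p)] at e3
  simp only [zero_apply] at e1 e2 e3
  exact ⟨by linarith, by linarith, by linarith⟩

/-- The induced connection has the single connection form `ω(u) = ⟨D_u s₁, s₂⟩`, by skew-symmetry of
the derivatives of an orthonormal pair. -/
theorem pairProj_mvfderiv (h₁ : SmoothMapAt s₁ p) (h₂ : SmoothMapAt s₂ p)
    (ho : ∀ᶠ q in 𝓝 p, AmbOrthonormal c₁ c₂ (s₁ q) (s₂ q)) {f g : M → ℝ}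
    (hf : ContMDiffAt (𝓡 2) 𝓘(ℝ, ℝ) ∞ f p) (hg : ContMDiffAt (𝓡 2) 𝓘(ℝ, ℝ) ∞ g p)
    (hV : ∀ᶠ q in 𝓝 p, V q = f q • s₁ q + g q • s₂ q) (u : TangentSpace (𝓡 2) p) :
    pairProj c₁ c₂ (s₁ p) (s₂ p) (mvfderiv (𝓡 2) V p u) =
      (mvfderiv (𝓡 2) f p u - g p * prodMetric c₁ c₂ (mvfderiv (𝓡 2) s₁ p u) (s₂ p)) • s₁ p +
      (mvfderiv (𝓡 2) g p u + f p * prodMetric c₁ c₂ (mvfderiv (𝓡 2) s₁ p u) (s₂ p)) • s₂ p := by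
  have d₁ := h₁.mdifferentiableAt
  have d₂ := h₂.mdifferentiableAt
  have df : MDifferentiableAt (𝓡 2) 𝓘(ℝ, ℝ) f p := hf.mdifferentiableAt (by simp)
  have dg : MDifferentiableAt (𝓡 2) 𝓘(ℝ, ℝ) g p := hg.mdifferentiableAt (by simp)
  obtain ⟨o1, o2, o3⟩ := prodMetric_mvfderiv_of_orthonormal h₁ h₂ ho u
  obtain ⟨p1, p2, p3⟩ := ho.self_of_nhds
  have p4 : prodMetric c₁ c₂ (s₂ p) (s₁ p) = 0 := by rw [prodMetric_comm, p3]
  rw [mvfderiv_congr (W := fun q ↦ f q • s₁ q + g q • s₂ q) hV,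
    mvfderiv_fun_add (g := fun q ↦ f q • s₁ q) (g' := fun q ↦ g q • s₂ q) (df.smul d₁)
      (dg.smul d₂), mvfderiv_fun_smul df d₁, mvfderiv_fun_smul dg d₂]
  simp [pairProj, o1, o2, o3, p1, p2, p3, p4]
  (congr 2; ring)

/-- The curvature of the connection induced on the plane bundle spanned by `s₁, s₂`. -/
theorem pairProj_curvature (h₁ : SmoothMapAt s₁ p) (h₂ : SmoothMapAt s₂ p)
    (ho : ∀ᶠ q in 𝓝 p, AmbOrthonormal c₁ c₂ (s₁ q) (s₂ q))
    (hsm : ∀ᶠ q in 𝓝 p, SmoothMapAt s₁ q ∧ SmoothMapAt s₂ q ∧ SmoothMapAt V q)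
    (hV : ∀ᶠ q in 𝓝 p, V q = pairProj c₁ c₂ (s₁ q) (s₂ q) (V q))
    {X Y : ∀ q : M, TangentSpace (𝓡 2) q} (hX : SmoothFieldAt X p) (hY : SmoothFieldAt Y p)
    {VX VY : M → Amb × Amb}
    (hVX : ∀ᶠ q in 𝓝 p, VX q = pairProj c₁ c₂ (s₁ q) (s₂ q) (mvfderiv (𝓡 2) V q (X q)))
    (hVY : ∀ᶠ q in 𝓝 p, VY q = pairProj c₁ c₂ (s₁ q) (s₂ q) (mvfderiv (𝓡 2) V q (Y q))) :
    pairProj c₁ c₂ (s₁ p) (s₂ p) (mvfderiv (𝓡 2) VY p (X p)) -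
      pairProj c₁ c₂ (s₁ p) (s₂ p) (mvfderiv (𝓡 2) VX p (Y p)) -
      pairProj c₁ c₂ (s₁ p) (s₂ p)
        (mvfderiv (𝓡 2) V p (VectorField.mlieBracket (𝓡 2) X Y p)) =
    (prodMetric c₁ c₂ (mvfderiv (𝓡 2) s₁ p (Y p)) (mvfderiv (𝓡 2) s₂ p (X p)) -
      prodMetric c₁ c₂ (mvfderiv (𝓡 2) s₁ p (X p)) (mvfderiv (𝓡 2) s₂ p (Y p))) •
      (prodMetric c₁ c₂ (V p) (s₁ p) • s₂ p - prodMetric c₁ c₂ (V p) (s₂ p) • s₁ p) := by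
  -- The rotation group of a plane is commutative, so the curvature is `dω` times the rotation by a
  -- right angle. The second derivatives of `f`, `g` and `s₁` cancel against the bracket terms, and
  -- only products of first derivatives of `s₁` and `s₂` remain.
  set f : M → ℝ := fun q ↦ prodMetric c₁ c₂ (V q) (s₁ q)
  set g : M → ℝ := fun q ↦ prodMetric c₁ c₂ (V q) (s₂ q)
  have hsV := hsm.self_of_nhds.2.2
  have hf : ContMDiffAt (𝓡 2) 𝓘(ℝ, ℝ) ∞ f p := hsV.prodMetric h₁
  have hg : ContMDiffAt (𝓡 2) 𝓘(ℝ, ℝ) ∞ g p := hsV.prodMetric h₂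
  have key : ∀ {Z : ∀ q : M, TangentSpace (𝓡 2) q} {W : M → Amb × Amb}, SmoothFieldAt Z p →
      (∀ᶠ q in 𝓝 p, W q = pairProj c₁ c₂ (s₁ q) (s₂ q) (mvfderiv (𝓡 2) V q (Z q))) →
      ∀ᶠ q in 𝓝 p, W q = (mvfderiv (𝓡 2) f q (Z q) -
        g q * prodMetric c₁ c₂ (mvfderiv (𝓡 2) s₁ q (Z q)) (s₂ q)) • s₁ q +
      (mvfderiv (𝓡 2) g q (Z q) +
        f q * prodMetric c₁ c₂ (mvfderiv (𝓡 2) s₁ q (Z q)) (s₂ q)) • s₂ q := by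
    intro Z W hZ hW
    filter_upwards [hW, ho.eventually_nhds, hsm, hV.eventually_nhds] with q h1 h2 h3 h4
    rw [h1]
    exact pairProj_mvfderiv h3.1 h3.2.1 h2 (h3.2.2.prodMetric h3.1) (h3.2.2.prodMetric h3.2.1) h4 _
  have hω : ∀ {Z : ∀ q : M, TangentSpace (𝓡 2) q}, SmoothFieldAt Z p →
      ContMDiffAt (𝓡 2) 𝓘(ℝ, ℝ) ∞
        (fun q ↦ prodMetric c₁ c₂ (mvfderiv (𝓡 2) s₁ q (Z q)) (s₂ q)) p :=
    fun hZ ↦ (hZ.smoothMapAt h₁).prodMetric h₂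
  have hFs : ∀ {Z : ∀ q : M, TangentSpace (𝓡 2) q}, SmoothFieldAt Z p →
      ContMDiffAt (𝓡 2) 𝓘(ℝ, ℝ) ∞ (fun q ↦ mvfderiv (𝓡 2) f q (Z q) -
        g q * prodMetric c₁ c₂ (mvfderiv (𝓡 2) s₁ q (Z q)) (s₂ q)) p :=
    fun hZ ↦ (hZ.mvfderiv_apply hf).sub (hg.mul (hω hZ))
  have hGs : ∀ {Z : ∀ q : M, TangentSpace (𝓡 2) q}, SmoothFieldAt Z p →
      ContMDiffAt (𝓡 2) 𝓘(ℝ, ℝ) ∞ (fun q ↦ mvfderiv (𝓡 2) g q (Z q) +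
        f q * prodMetric c₁ c₂ (mvfderiv (𝓡 2) s₁ q (Z q)) (s₂ q)) p :=
    fun hZ ↦ (hZ.mvfderiv_apply hg).add (hf.mul (hω hZ))
  rw [pairProj_mvfderiv h₁ h₂ ho (hFs hY) (hGs hY) (key hY hVY),
    pairProj_mvfderiv h₁ h₂ ho (hFs hX) (hGs hX) (key hX hVX),
    pairProj_mvfderiv h₁ h₂ ho hf hg hV, mvfderiv_commutator hf hX hY,
    mvfderiv_commutator hg hX hY, mvfderiv_commutator h₁ hX hY]
  have D : ∀ {a : M → ℝ}, ContMDiffAt (𝓡 2) 𝓘(ℝ, ℝ) ∞ a p →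
      MDifferentiableAt (𝓡 2) 𝓘(ℝ, ℝ) a p := fun h ↦ h.mdifferentiableAt (by simp)
  have hder : ∀ {Z W : ∀ q : M, TangentSpace (𝓡 2) q} (_ : SmoothFieldAt Z p),
      mvfderiv (𝓡 2) (fun q ↦ mvfderiv (𝓡 2) f q (Z q) -
        g q * prodMetric c₁ c₂ (mvfderiv (𝓡 2) s₁ q (Z q)) (s₂ q)) p (W p) =
      mvfderiv (𝓡 2) (fun q ↦ mvfderiv (𝓡 2) f q (Z q)) p (W p) -
        (g p * (prodMetric c₁ c₂
            (mvfderiv (𝓡 2) (fun q ↦ mvfderiv (𝓡 2) s₁ q (Z q)) p (W p)) (s₂ p) +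
          prodMetric c₁ c₂ (mvfderiv (𝓡 2) s₁ p (Z p)) (mvfderiv (𝓡 2) s₂ p (W p))) +
        prodMetric c₁ c₂ (mvfderiv (𝓡 2) s₁ p (Z p)) (s₂ p) * mvfderiv (𝓡 2) g p (W p)) := by
    intro Z W hZ
    rw [mvfderiv_fun_sub (g' := fun q ↦ g q *
        prodMetric c₁ c₂ (mvfderiv (𝓡 2) s₁ q (Z q)) (s₂ q)) (D (hZ.mvfderiv_apply hf)) (D (hg.mul (hω hZ))),
      mvfderiv_fun_mul (D hg) (D (hω hZ))]
    simp [mvfderiv_prodMetric (hZ.smoothMapAt h₁).mdifferentiableAt h₂.mdifferentiableAt]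
  have hder' : ∀ {Z W : ∀ q : M, TangentSpace (𝓡 2) q} (_ : SmoothFieldAt Z p),
      mvfderiv (𝓡 2) (fun q ↦ mvfderiv (𝓡 2) g q (Z q) +
        f q * prodMetric c₁ c₂ (mvfderiv (𝓡 2) s₁ q (Z q)) (s₂ q)) p (W p) =
      mvfderiv (𝓡 2) (fun q ↦ mvfderiv (𝓡 2) g q (Z q)) p (W p) +
        (f p * (prodMetric c₁ c₂
            (mvfderiv (𝓡 2) (fun q ↦ mvfderiv (𝓡 2) s₁ q (Z q)) p (W p)) (s₂ p) +
          prodMetric c₁ c₂ (mvfderiv (𝓡 2) s₁ p (Z p)) (mvfderiv (𝓡 2) s₂ p (W p))) +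
        prodMetric c₁ c₂ (mvfderiv (𝓡 2) s₁ p (Z p)) (s₂ p) * mvfderiv (𝓡 2) f p (W p)) := by
    intro Z W hZ
    rw [mvfderiv_fun_add (g' := fun q ↦ f q *
        prodMetric c₁ c₂ (mvfderiv (𝓡 2) s₁ q (Z q)) (s₂ q)) (D (hZ.mvfderiv_apply hg)) (D (hf.mul (hω hZ))),
      mvfderiv_fun_mul (D hf) (D (hω hZ))]
    simp [mvfderiv_prodMetric (hZ.smoothMapAt h₁).mdifferentiableAt h₂.mdifferentiableAt]
  rw [hder hX, hder hY, hder' hX, hder' hY]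
  simp only [prodMetric_sub_left]
  change _ = _ • (f p • s₂ p - g p • s₁ p)
  module

end PlaneBundle

end ConstantAngle

end

/-! ### The special frame and its first derivatives. -/

noncomputable section

namespace ConstantAngle

variable {M : Type*} [TopologicalSpace M] [ChartedSpace (EuclideanSpace ℝ (Fin 2)) M]
  [IsManifold (𝓡 2) ∞ M] {c₁ c₂ : ℝ} {ψ : M → Amb × Amb} {q : M}

omit [IsManifold (𝓡 2) ∞ M] in
theorem form_mvfderiv_of_eventually_const {c a : ℝ} {V W : M → Amb}
    (hV : MDifferentiableAt (𝓡 2) 𝓘(ℝ, Amb) V q) (hW : MDifferentiableAt (𝓡 2) 𝓘(ℝ, Amb) W q)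
    (h : ∀ᶠ r in 𝓝 q, form c (V r) (W r) = a) (u : TangentSpace (𝓡 2) q) :
    form c (mvfderiv (𝓡 2) V q u) (W q) = -form c (mvfderiv (𝓡 2) W q u) (V q) := by
  have := mvfderiv_form (c := c) hV hW u
  rw [mvfderiv_eq_zero_of_eventually_const h, form_comm c (V q)] at this
  simp only [zero_apply] at this
  linarith

/-- An adapted frame of a surface with `f = diag(-1, C² - S²)`: `e₁` is tangent to the second
factor, `ξ₁` is tangent to the first one, and `ξ₂` is determined by `e₂`. -/
structure IsSpecialFrame (c₁ c₂ : ℝ) (ψ : M → Amb × Amb) (C S : ℝ) (U : Set M)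
    (e₁ e₂ : ∀ q : M, TangentSpace (𝓡 2) q) (ξ₁ ξ₂ : M → Amb × Amb) : Prop
    extends IsAdaptedFrame c₁ c₂ ψ U e₁ e₂ ξ₁ ξ₂ where
  isOpen : IsOpen U
  pos_C : 0 < C
  pos_S : 0 < S
  sq_add_sq : C ^ 2 + S ^ 2 = 1
  fst_e₁ : ∀ q ∈ U, (mvfderiv (𝓡 2) ψ q (e₁ q)).1 = 0
  snd_ξ₁ : ∀ q ∈ U, (ξ₁ q).2 = 0
  ξ₂_eq : ∀ q ∈ U, ξ₂ q = ((S / C) • (mvfderiv (𝓡 2) ψ q (e₂ q)).1,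
    -((C / S) • (mvfderiv (𝓡 2) ψ q (e₂ q)).2))
  form_fst : ∀ q ∈ U, form c₁ (mvfderiv (𝓡 2) ψ q (e₂ q)).1 (mvfderiv (𝓡 2) ψ q (e₂ q)).1 = C ^ 2
  form_snd : ∀ q ∈ U, form c₂ (mvfderiv (𝓡 2) ψ q (e₂ q)).2 (mvfderiv (𝓡 2) ψ q (e₂ q)).2 = S ^ 2

namespace IsSpecialFrame

variable {C S : ℝ} {U : Set M} {e₁ e₂ : ∀ q : M, TangentSpace (𝓡 2) q} {ξ₁ ξ₂ : M → Amb × Amb}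
  (h : IsSpecialFrame c₁ c₂ ψ C S U e₁ e₂ ξ₁ ξ₂) (hψ : IsImmersedSurface c₁ c₂ ψ) (hq : q ∈ U)

include h hq

theorem form_e₁_e₁ : form c₂ (mvfderiv (𝓡 2) ψ q (e₁ q)).2 (mvfderiv (𝓡 2) ψ q (e₁ q)).2 = 1 := by
  simpa [indMetric, prodMetric, h.fst_e₁ q hq] using (h.orthonormal_tangent q hq).1

theorem form_e₁_e₂ : form c₂ (mvfderiv (𝓡 2) ψ q (e₁ q)).2 (mvfderiv (𝓡 2) ψ q (e₂ q)).2 = 0 := by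
  simpa [indMetric, prodMetric, h.fst_e₁ q hq] using (h.orthonormal_tangent q hq).2.2

theorem form_ξ₁_ξ₁ : form c₁ (ξ₁ q).1 (ξ₁ q).1 = 1 := by
  simpa [prodMetric, h.snd_ξ₁ q hq] using (h.orthonormal_normal q hq).1

theorem form_ξ₁_e₂ : form c₁ (ξ₁ q).1 (mvfderiv (𝓡 2) ψ q (e₂ q)).1 = 0 := by
  simpa [prodMetric, h.snd_ξ₁ q hq] using (h.isNormal q hq).1.2 (e₂ q)

theorem prodMetric_e₁ (v : Amb × Amb) : prodMetric c₁ c₂ v (mvfderiv (𝓡 2) ψ q (e₁ q)) =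
    form c₂ v.2 (mvfderiv (𝓡 2) ψ q (e₁ q)).2 := by
  simp [prodMetric, h.fst_e₁ q hq]

theorem prodMetric_ξ₁ (v : Amb × Amb) : prodMetric c₁ c₂ v (ξ₁ q) = form c₁ v.1 (ξ₁ q).1 := by
  simp [prodMetric, h.snd_ξ₁ q hq]

theorem prodMetric_ξ₂ (v : Amb × Amb) : prodMetric c₁ c₂ v (ξ₂ q) =
    S / C * form c₁ v.1 (mvfderiv (𝓡 2) ψ q (e₂ q)).1 -
      C / S * form c₂ v.2 (mvfderiv (𝓡 2) ψ q (e₂ q)).2 := by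
  simp [prodMetric, h.ξ₂_eq q hq]; ring

omit hq in
theorem mem_nhds {r : M} (hr : r ∈ U) : ∀ᶠ q in 𝓝 r, q ∈ U := h.isOpen.mem_nhds hr

include hψ

/-- Expansion in the orthonormal basis formed by the unit normal, `ξ₁` and `a / C`, where `a` is the
first component of `dψ e₂`. -/
theorem eq_sum_fst {w : Amb} :
    w = (normalSign c₁ * form c₁ w (unitNormal c₁ (ψ q).1)) • unitNormal c₁ (ψ q).1 +
      form c₁ w (ξ₁ q).1 • (ξ₁ q).1 +
      (C ^ 2)⁻¹ • form c₁ w (mvfderiv (𝓡 2) ψ q (e₂ q)).1 • (mvfderiv (𝓡 2) ψ q (e₂ q)).1 := by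
  have hC := h.pos_C.ne'
  have h1 := mem_prodTangent_iff.1 (hψ.mvfderiv_mem q (e₂ q))
  have h2 := mem_prodTangent_iff.1 (h.isNormal q hq).1.1
  have := eq_sum_of_orthonormal (form_unitNormal_self (hψ.mem q).1) (h.form_ξ₁_ξ₁ hq)
    (b := C⁻¹ • (mvfderiv (𝓡 2) ψ q (e₂ q)).1)
    (by simp [h.form_fst q hq]; field_simp) h2.1 (by simp [h1.1])
    (by simp [h.form_ξ₁_e₂ hq]) w
  nth_rewrite 1 [this]
  simp only [form_smul_right, smul_smul]
  congr 2
  field_simp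

theorem eq_sum_snd {w : Amb} :
    w = (normalSign c₂ * form c₂ w (unitNormal c₂ (ψ q).2)) • unitNormal c₂ (ψ q).2 +
      form c₂ w (mvfderiv (𝓡 2) ψ q (e₁ q)).2 • (mvfderiv (𝓡 2) ψ q (e₁ q)).2 +
      (S ^ 2)⁻¹ • form c₂ w (mvfderiv (𝓡 2) ψ q (e₂ q)).2 • (mvfderiv (𝓡 2) ψ q (e₂ q)).2 := by
  have hS := h.pos_S.ne'
  have h1 := mem_prodTangent_iff.1 (hψ.mvfderiv_mem q (e₂ q))
  have h2 := mem_prodTangent_iff.1 (hψ.mvfderiv_mem q (e₁ q))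
  have := eq_sum_of_orthonormal (form_unitNormal_self (hψ.mem q).2) (h.form_e₁_e₁ hq)
    (b := S⁻¹ • (mvfderiv (𝓡 2) ψ q (e₂ q)).2)
    (by simp [h.form_snd q hq]; field_simp) h2.2 (by simp [h1.2])
    (by simp [h.form_e₁_e₂ hq]) w
  nth_rewrite 1 [this]
  simp only [form_smul_right, smul_smul]
  congr 2
  field_simp

/-- A normal vector is determined by its components along `ξ₁, ξ₂`. -/
theorem pairProj_eq_self {v : Amb × Amb} (hv : IsNormal c₁ c₂ ψ q v) :
    v = pairProj c₁ c₂ (ξ₁ q) (ξ₂ q) v := by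
  have hC := h.pos_C.ne'
  have hS := h.pos_S.ne'
  have hsq := h.sq_add_sq
  have hv1 := mem_prodTangent_iff.1 hv.1
  have hv2 := hv.2 (e₁ q)
  rw [h.prodMetric_e₁ hq] at hv2
  have hv3 := hv.2 (e₂ q)
  simp only [prodMetric] at hv3
  have x1 := h.eq_sum_fst hψ hq (w := v.1)
  have x2 := h.eq_sum_snd hψ hq (w := v.2)
  rw [form_comm, hv1.1] at x1
  rw [form_comm, hv1.2, hv2] at x2
  rw [pairProj, h.prodMetric_ξ₁ hq, h.prodMetric_ξ₂ hq]
  -- Orthogonality to `e₂` makes the two pairings opposite, so a single coefficient describes the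
  -- part of `v` along `ξ₂`. The factor `(S * C)⁻¹` below is `S / C + C / S`.
  have hk : form c₂ v.2 (mvfderiv (𝓡 2) ψ q (e₂ q)).2 =
    -form c₁ v.1 (mvfderiv (𝓡 2) ψ q (e₂ q)).1 := by linarith
  rw [hk] at x2 ⊢
  have hk2 : S / C * form c₁ v.1 (mvfderiv (𝓡 2) ψ q (e₂ q)).1 -
      C / S * -form c₁ v.1 (mvfderiv (𝓡 2) ψ q (e₂ q)).1 =
      form c₁ v.1 (mvfderiv (𝓡 2) ψ q (e₂ q)).1 * (S * C)⁻¹ := by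
    field_simp
    linear_combination form c₁ v.1 (mvfderiv (𝓡 2) ψ q (e₂ q)).1 * hsq
  rw [hk2]
  ext1
  · rw [Prod.fst_add, Prod.smul_fst, Prod.smul_fst, h.ξ₂_eq q hq]
    nth_rewrite 1 [x1]
    simp only [smul_smul, mul_zero, zero_smul, zero_add]
    congr 2
    field_simp
  · rw [Prod.snd_add, Prod.smul_snd, Prod.smul_snd, h.ξ₂_eq q hq, h.snd_ξ₁ q hq]
    nth_rewrite 1 [x2]
    simp only [smul_smul, mul_zero, zero_smul, zero_add, smul_zero, ← neg_smul]
    congr 1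
    field_simp

/-! ### First derivatives of the frame -/

theorem smoothMapAt_e₁ : SmoothMapAt (fun r ↦ mvfderiv (𝓡 2) ψ r (e₁ r)) q :=
  (h.smooth_tangent q hq).1.smoothMapAt (hψ.smoothMapAt q)

theorem smoothMapAt_e₂ : SmoothMapAt (fun r ↦ mvfderiv (𝓡 2) ψ r (e₂ r)) q :=
  (h.smooth_tangent q hq).2.smoothMapAt (hψ.smoothMapAt q)

variable (u : TangentSpace (𝓡 2) q)

theorem fst_mvfderiv_e₁ : (mvfderiv (𝓡 2) (fun r ↦ mvfderiv (𝓡 2) ψ r (e₁ r)) q u).1 = 0 := by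
  rw [← mvfderiv_fst (h.smoothMapAt_e₁ hψ hq).mdifferentiableAt,
    mvfderiv_eq_zero_of_eventually_const ((h.mem_nhds hq).mono h.fst_e₁)]
  rfl

omit hψ in
theorem snd_mvfderiv_ξ₁ : (mvfderiv (𝓡 2) ξ₁ q u).2 = 0 := by
  rw [← mvfderiv_snd (h.smooth_normal q hq).1.mdifferentiableAt,
    mvfderiv_eq_zero_of_eventually_const ((h.mem_nhds hq).mono h.snd_ξ₁)]
  rfl

/-- `ξ₂` is a constant linear map applied to `dψ e₂`, so its derivative carries no new information.
-/
theorem mvfderiv_ξ₂ : mvfderiv (𝓡 2) ξ₂ q u =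
    ((S / C) • (mvfderiv (𝓡 2) (fun r ↦ mvfderiv (𝓡 2) ψ r (e₂ r)) q u).1,
      -((C / S) • (mvfderiv (𝓡 2) (fun r ↦ mvfderiv (𝓡 2) ψ r (e₂ r)) q u).2)) := by
  rw [mvfderiv_congr (W := fun q ↦ ((S / C) • (mvfderiv (𝓡 2) ψ q (e₂ q)).1,
    -((C / S) • (mvfderiv (𝓡 2) ψ q (e₂ q)).2))) ((h.mem_nhds hq).mono h.ξ₂_eq)]
  have := mvfderiv_clm_comp (((S / C) • ContinuousLinearMap.fst ℝ Amb Amb).prod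
    (-((C / S) • ContinuousLinearMap.snd ℝ Amb Amb)))
    (h.smoothMapAt_e₂ hψ hq).mdifferentiableAt u
  simpa using this

theorem form_mvfderiv_e₁_e₁ : form c₂ (mvfderiv (𝓡 2) (fun r ↦ mvfderiv (𝓡 2) ψ r (e₁ r)) q u).2
    (mvfderiv (𝓡 2) ψ q (e₁ q)).2 = 0 := by
  have d := (h.smoothMapAt_e₁ hψ hq).mdifferentiableAt
  have := form_mvfderiv_of_eventually_const (mdifferentiableAt_snd d) (mdifferentiableAt_snd d)
    ((h.mem_nhds hq).mono fun r hr ↦ h.form_e₁_e₁ hr) u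
  rw [mvfderiv_snd d] at this
  linarith

theorem form_mvfderiv_e₂_e₂_snd :
    form c₂ (mvfderiv (𝓡 2) (fun r ↦ mvfderiv (𝓡 2) ψ r (e₂ r)) q u).2
    (mvfderiv (𝓡 2) ψ q (e₂ q)).2 = 0 := by
  have d := (h.smoothMapAt_e₂ hψ hq).mdifferentiableAt
  have := form_mvfderiv_of_eventually_const (mdifferentiableAt_snd d) (mdifferentiableAt_snd d)
    ((h.mem_nhds hq).mono fun r hr ↦ h.form_snd r hr) u
  rw [mvfderiv_snd d] at this
  linarith

theorem form_mvfderiv_e₂_e₂_fst :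
    form c₁ (mvfderiv (𝓡 2) (fun r ↦ mvfderiv (𝓡 2) ψ r (e₂ r)) q u).1
    (mvfderiv (𝓡 2) ψ q (e₂ q)).1 = 0 := by
  have d := (h.smoothMapAt_e₂ hψ hq).mdifferentiableAt
  have := form_mvfderiv_of_eventually_const (mdifferentiableAt_fst d) (mdifferentiableAt_fst d)
    ((h.mem_nhds hq).mono fun r hr ↦ h.form_fst r hr) u
  rw [mvfderiv_fst d] at this
  linarith

theorem form_mvfderiv_e₂_e₁ :
    form c₂ (mvfderiv (𝓡 2) (fun r ↦ mvfderiv (𝓡 2) ψ r (e₂ r)) q u).2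
      (mvfderiv (𝓡 2) ψ q (e₁ q)).2 =
    -form c₂ (mvfderiv (𝓡 2) (fun r ↦ mvfderiv (𝓡 2) ψ r (e₁ r)) q u).2
      (mvfderiv (𝓡 2) ψ q (e₂ q)).2 := by
  have d1 := (h.smoothMapAt_e₁ hψ hq).mdifferentiableAt
  have d := (h.smoothMapAt_e₂ hψ hq).mdifferentiableAt
  have := form_mvfderiv_of_eventually_const (mdifferentiableAt_snd d1) (mdifferentiableAt_snd d)
    ((h.mem_nhds hq).mono fun r hr ↦ h.form_e₁_e₂ hr) u
  rw [mvfderiv_snd d, mvfderiv_snd d1] at this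
  linarith

omit hψ in
theorem form_mvfderiv_ξ₁_ξ₁ : form c₁ (mvfderiv (𝓡 2) ξ₁ q u).1 (ξ₁ q).1 = 0 := by
  have d := (h.smooth_normal q hq).1.mdifferentiableAt
  have := form_mvfderiv_of_eventually_const (mdifferentiableAt_fst d) (mdifferentiableAt_fst d)
    ((h.mem_nhds hq).mono fun r hr ↦ h.form_ξ₁_ξ₁ hr) u
  rw [mvfderiv_fst d] at this
  linarith

theorem form_mvfderiv_e₂_ξ₁ :
    form c₁ (mvfderiv (𝓡 2) (fun r ↦ mvfderiv (𝓡 2) ψ r (e₂ r)) q u).1 (ξ₁ q).1 =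
    -form c₁ (mvfderiv (𝓡 2) ξ₁ q u).1 (mvfderiv (𝓡 2) ψ q (e₂ q)).1 := by
  have d := (h.smoothMapAt_e₂ hψ hq).mdifferentiableAt
  have d1 := (h.smooth_normal q hq).1.mdifferentiableAt
  have := form_mvfderiv_of_eventually_const (mdifferentiableAt_fst d1) (mdifferentiableAt_fst d)
    ((h.mem_nhds hq).mono fun r hr ↦ h.form_ξ₁_e₂ hr) u
  rw [mvfderiv_fst d, mvfderiv_fst d1] at this
  linarith

omit h hq in
-- The derivative of the unit normal is `√|c₁|` times that of the position: space forms are umbilic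
-- in the ambient space. This is how the curvature constants enter.
theorem form_mvfderiv_unitNormal_fst {V : M → Amb}
    (hV : MDifferentiableAt (𝓡 2) 𝓘(ℝ, Amb) V q)
    (hn : ∀ᶠ r in 𝓝 q, form c₁ (unitNormal c₁ (ψ r).1) (V r) = 0) :
    form c₁ (mvfderiv (𝓡 2) V q u) (unitNormal c₁ (ψ q).1) =
      -(√|c₁| * form c₁ (mvfderiv (𝓡 2) ψ q u).1 (V q)) := by
  have dψ := hψ.mdifferentiableAt q
  have dN : MDifferentiableAt (𝓡 2) 𝓘(ℝ, Amb) (fun r ↦ unitNormal c₁ (ψ r).1) q :=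
    (contMDiffAt_unitNormal c₁ (contMDiffAt_fst (hψ.smoothMapAt q))).mdifferentiableAt (by simp)
  have := form_mvfderiv_of_eventually_const dN hV hn u
  rw [mvfderiv_unitNormal c₁ (mdifferentiableAt_fst dψ), mvfderiv_fst dψ, form_smul_left] at this
  linarith

omit h hq in
theorem form_mvfderiv_unitNormal_snd {V : M → Amb}
    (hV : MDifferentiableAt (𝓡 2) 𝓘(ℝ, Amb) V q)
    (hn : ∀ᶠ r in 𝓝 q, form c₂ (unitNormal c₂ (ψ r).2) (V r) = 0) :
    form c₂ (mvfderiv (𝓡 2) V q u) (unitNormal c₂ (ψ q).2) =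
      -(√|c₂| * form c₂ (mvfderiv (𝓡 2) ψ q u).2 (V q)) := by
  have dψ := hψ.mdifferentiableAt q
  have dN : MDifferentiableAt (𝓡 2) 𝓘(ℝ, Amb) (fun r ↦ unitNormal c₂ (ψ r).2) q :=
    (contMDiffAt_unitNormal c₂ (contMDiffAt_snd (hψ.smoothMapAt q))).mdifferentiableAt (by simp)
  have := form_mvfderiv_of_eventually_const dN hV hn u
  rw [mvfderiv_unitNormal c₂ (mdifferentiableAt_snd dψ), mvfderiv_snd dψ, form_smul_left] at this
  linarith

/-! ### The torsion-free condition -/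

/-- The tangent vector `dψ [e₁, e₂]` is orthogonal to `ξ₁`. In the commutator `D_{e₂} e₁` has no
first component, and `D_{e₁} e₂` pairs with `ξ₁` to minus the left-hand side. -/
theorem form_mvfderiv_ξ₁_e₁ :
    form c₁ (mvfderiv (𝓡 2) ξ₁ q (e₁ q)).1 (mvfderiv (𝓡 2) ψ q (e₂ q)).1 = 0 := by
  have ht := mvfderiv_commutator (hψ.smoothMapAt q) (h.smooth_tangent q hq).1
    (h.smooth_tangent q hq).2
  have := (h.isNormal q hq).1.2 (VectorField.mlieBracket (𝓡 2) e₁ e₂ q)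
  rw [ht, prodMetric_comm, prodMetric_sub_left, h.prodMetric_ξ₁ hq, h.prodMetric_ξ₁ hq,
    h.fst_mvfderiv_e₁ hψ hq, h.form_mvfderiv_e₂_ξ₁ hψ hq] at this
  simpa using this

/-- Here the commutator is paired with `ξ₂`. Since the components of `dψ e₂` have constant length,
`D_{e₁} e₂` contributes nothing and only `D_{e₂} e₁` survives. -/
theorem form_mvfderiv_e₁_e₂ :
    form c₂ (mvfderiv (𝓡 2) (fun r ↦ mvfderiv (𝓡 2) ψ r (e₁ r)) q (e₂ q)).2
      (mvfderiv (𝓡 2) ψ q (e₂ q)).2 = 0 := by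
  have ht := mvfderiv_commutator (hψ.smoothMapAt q) (h.smooth_tangent q hq).1
    (h.smooth_tangent q hq).2
  have := (h.isNormal q hq).2.2 (VectorField.mlieBracket (𝓡 2) e₁ e₂ q)
  rw [ht, prodMetric_comm, prodMetric_sub_left, h.prodMetric_ξ₂ hq, h.prodMetric_ξ₂ hq,
    h.fst_mvfderiv_e₁ hψ hq, h.form_mvfderiv_e₂_e₂_snd hψ hq,
    h.form_mvfderiv_e₂_e₂_fst hψ hq] at this
  simpa [h.pos_C.ne', h.pos_S.ne'] using this

theorem form_mvfderiv_ξ₁_eq :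
    form c₁ (mvfderiv (𝓡 2) ξ₁ q u).1 (mvfderiv (𝓡 2) ψ q (e₂ q)).1 =
      indMetric c₁ c₂ ψ q u (e₂ q) *
        form c₁ (mvfderiv (𝓡 2) ξ₁ q (e₂ q)).1 (mvfderiv (𝓡 2) ψ q (e₂ q)).1 := by
  nth_rewrite 1 [(h.orthonormal_tangent q hq).eq_sum u]
  simp [h.form_mvfderiv_ξ₁_e₁ hψ hq]

theorem form_mvfderiv_e₁_eq :
    form c₂ (mvfderiv (𝓡 2) (fun r ↦ mvfderiv (𝓡 2) ψ r (e₁ r)) q u).2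
      (mvfderiv (𝓡 2) ψ q (e₂ q)).2 =
    indMetric c₁ c₂ ψ q u (e₁ q) *
      form c₂ (mvfderiv (𝓡 2) (fun r ↦ mvfderiv (𝓡 2) ψ r (e₁ r)) q (e₁ q)).2
      (mvfderiv (𝓡 2) ψ q (e₂ q)).2 := by
  nth_rewrite 1 [(h.orthonormal_tangent q hq).eq_sum u]
  simp [h.form_mvfderiv_e₁_e₂ hψ hq]

end IsSpecialFrame

end ConstantAngle

end

/-! ### Shape operators, connections and curvatures in the special frame. -/

noncomputable section

namespace ConstantAngle

variable {M : Type*} [TopologicalSpace M] [ChartedSpace (EuclideanSpace ℝ (Fin 2)) M]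
  [IsManifold (𝓡 2) ∞ M] {c₁ c₂ : ℝ} {ψ : M → Amb × Amb} {q : M}

omit [IsManifold (𝓡 2) ∞ M] in
theorem IsImmersedSurface.tanPart_eq_zero (hψ : IsImmersedSurface c₁ c₂ ψ) {v : Amb × Amb}
    (hv : IsNormal c₁ c₂ ψ q v) : tanPart c₁ c₂ ψ q v = 0 :=
  hψ.tanPart_eq_of_forall fun w ↦ by rw [hv.2 w]; simp [indMetric]

omit [IsManifold (𝓡 2) ∞ M] in
theorem IsImmersedSurface.mvfderiv_tanPart (hψ : IsImmersedSurface c₁ c₂ ψ)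
    {u v : TangentSpace (𝓡 2) q} (h : TanOrthonormal c₁ c₂ ψ q u v) (w : Amb × Amb) :
    mvfderiv (𝓡 2) ψ q (tanPart c₁ c₂ ψ q w) =
      pairProj c₁ c₂ (mvfderiv (𝓡 2) ψ q u) (mvfderiv (𝓡 2) ψ q v) w := by
  rw [hψ.tanPart_eq h, map_add, map_smul, map_smul, pairProj]

namespace IsSpecialFrame

variable {C S : ℝ} {U : Set M} {e₁ e₂ : ∀ q : M, TangentSpace (𝓡 2) q} {ξ₁ ξ₂ : M → Amb × Amb}
  (h : IsSpecialFrame c₁ c₂ ψ C S U e₁ e₂ ξ₁ ξ₂) (hψ : IsImmersedSurface c₁ c₂ ψ) (hq : q ∈ U)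

include h hq

include hψ

theorem fTensor_e₁ : fTensor c₁ c₂ ψ q (e₁ q) = -e₁ q := by
  have : prodStructure (mvfderiv (𝓡 2) ψ q (e₁ q)) = mvfderiv (𝓡 2) ψ q (-e₁ q) := by
    rw [map_neg]
    ext1 <;> simp [prodStructure, h.fst_e₁ q hq]
  rw [fTensor, this, hψ.tanPart_mvfderiv]

theorem fTensor_e₂ : fTensor c₁ c₂ ψ q (e₂ q) = (C ^ 2 - S ^ 2) • e₂ q := by
  rw [fTensor, hψ.tanPart_eq (h.orthonormal_tangent q hq), h.prodMetric_e₁ hq]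
  simp [prodMetric, prodStructure, form_comm c₂ _ (mvfderiv (𝓡 2) ψ q (e₁ q)).2,
    h.form_e₁_e₂ hq, h.form_fst q hq, h.form_snd q hq, sub_eq_add_neg]

theorem tTensor_ξ₁ : tTensor c₁ c₂ ψ q (ξ₁ q) = ξ₁ q := by
  have : prodStructure (ξ₁ q) = ξ₁ q := by
    ext1 <;> simp [prodStructure, h.snd_ξ₁ q hq]
  rw [tTensor, norPart, this, hψ.tanPart_eq_zero (h.isNormal q hq).1, map_zero, sub_zero]

theorem tTensor_ξ₂ : tTensor c₁ c₂ ψ q (ξ₂ q) = -((C ^ 2 - S ^ 2) • ξ₂ q) := by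
  have hC := h.pos_C.ne'
  have hS := h.pos_S.ne'
  have hsq := h.sq_add_sq
  have h1 : prodMetric c₁ c₂ (prodStructure (ξ₂ q)) (mvfderiv (𝓡 2) ψ q (e₁ q)) = 0 := by
    rw [h.prodMetric_e₁ hq]
    simp [prodStructure, h.ξ₂_eq q hq, form_comm c₂ _ (mvfderiv (𝓡 2) ψ q (e₁ q)).2,
      h.form_e₁_e₂ hq]
  -- The tangential part of `F ξ₂` is `2SC e₂`; subtracting it turns the coefficient `S / C` into
  -- `(S / C)(1 - 2C²)`, and similarly in the second factor.
  have h2 : prodMetric c₁ c₂ (prodStructure (ξ₂ q)) (mvfderiv (𝓡 2) ψ q (e₂ q)) = 2 * S * C := by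
    simp [prodStructure, prodMetric, h.ξ₂_eq q hq, h.form_fst q hq, h.form_snd q hq]
    field_simp
    ring
  rw [tTensor, norPart, hψ.mvfderiv_tanPart (h.orthonormal_tangent q hq), pairProj, h1, h2]
  ext1
  · simp [prodStructure, h.ξ₂_eq q hq, ← sub_smul, smul_smul, ← neg_smul]
    congr 1
    field_simp
    linear_combination (-1) * hsq
  · simp [prodStructure, h.ξ₂_eq q hq, ← sub_smul, smul_smul, ← neg_smul]
    congr 1
    field_simp
    linear_combination (-1) * hsq

theorem shapeOp_ξ₁ (u : TangentSpace (𝓡 2) q) : shapeOp c₁ c₂ ψ ξ₁ q u =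
    -(form c₁ (mvfderiv (𝓡 2) ξ₁ q u).1 (mvfderiv (𝓡 2) ψ q (e₂ q)).1) • e₂ q := by
  rw [hψ.shapeOp_eq, hψ.tanPart_eq (h.orthonormal_tangent q hq), h.prodMetric_e₁ hq,
    h.snd_mvfderiv_ξ₁ hq]
  simp [prodMetric, h.snd_mvfderiv_ξ₁ hq]

theorem shapeOp_ξ₂ (u : TangentSpace (𝓡 2) q) : shapeOp c₁ c₂ ψ ξ₂ q u =
    -(C / S * form c₂ (mvfderiv (𝓡 2) (fun r ↦ mvfderiv (𝓡 2) ψ r (e₁ r)) q u).2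
      (mvfderiv (𝓡 2) ψ q (e₂ q)).2) • e₁ q := by
  rw [hψ.shapeOp_eq, hψ.tanPart_eq (h.orthonormal_tangent q hq), h.prodMetric_e₁ hq,
    h.mvfderiv_ξ₂ hψ hq]
  simp [prodMetric, h.form_mvfderiv_e₂_e₁ hψ hq, h.form_mvfderiv_e₂_e₂_fst hψ hq,
    h.form_mvfderiv_e₂_e₂_snd hψ hq]

theorem indMetric_leviCivita {X : ∀ q : M, TangentSpace (𝓡 2) q} (hX : SmoothFieldAt X q) :
    indMetric c₁ c₂ ψ q (leviCivita c₁ c₂ ψ X e₁ q) (e₂ q) =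
      form c₂ (mvfderiv (𝓡 2) (fun r ↦ mvfderiv (𝓡 2) ψ r (e₁ r)) q (X q)).2
        (mvfderiv (𝓡 2) ψ q (e₂ q)).2 ∧
    indMetric c₁ c₂ ψ q (leviCivita c₁ c₂ ψ X e₂ q) (e₁ q) =
      -form c₂ (mvfderiv (𝓡 2) (fun r ↦ mvfderiv (𝓡 2) ψ r (e₁ r)) q (X q)).2
        (mvfderiv (𝓡 2) ψ q (e₂ q)).2 := by
  rw [hψ.leviCivita_eq hX (h.smooth_tangent q hq).1, hψ.leviCivita_eq hX (h.smooth_tangent q hq).2,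
    hψ.indMetric_tanPart, hψ.indMetric_tanPart, h.prodMetric_e₁ hq, h.form_mvfderiv_e₂_e₁ hψ hq]
  simp [prodMetric, h.fst_mvfderiv_e₁ hψ hq]

theorem prodMetric_normalConn (u : TangentSpace (𝓡 2) q) :
    prodMetric c₁ c₂ (normalConn c₁ c₂ ψ ξ₁ q u) (ξ₂ q) =
      S / C * form c₁ (mvfderiv (𝓡 2) ξ₁ q u).1 (mvfderiv (𝓡 2) ψ q (e₂ q)).1 ∧
    prodMetric c₁ c₂ (normalConn c₁ c₂ ψ ξ₂ q u) (ξ₁ q) =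
      -(S / C * form c₁ (mvfderiv (𝓡 2) ξ₁ q u).1 (mvfderiv (𝓡 2) ψ q (e₂ q)).1) := by
  rw [hψ.prodMetric_normalConn _ _ (h.isNormal q hq).2,
    hψ.prodMetric_normalConn _ _ (h.isNormal q hq).1, h.prodMetric_ξ₂ hq, h.prodMetric_ξ₁ hq,
    h.mvfderiv_ξ₂ hψ hq, h.snd_mvfderiv_ξ₁ hq]
  simp [h.form_mvfderiv_e₂_ξ₁ hψ hq]

theorem normalConn_eq (η : M → Amb × Amb) (u : TangentSpace (𝓡 2) q) :
    normalConn c₁ c₂ ψ η q u = pairProj c₁ c₂ (ξ₁ q) (ξ₂ q) (mvfderiv (𝓡 2) η q u) := by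
  rw [h.pairProj_eq_self hψ hq (hψ.isNormal_normalConn η q u), pairProj,
    hψ.prodMetric_normalConn _ _ (h.isNormal q hq).2,
    hψ.prodMetric_normalConn _ _ (h.isNormal q hq).1]
  rfl

/-- `D e₁` lies in the second factor with no `e₁` component there, and `D e₂` has no component along
`(dψ e₂).2`. So only the unit normal components multiply; they carry `√|c₂|` each, and `normalSign
c₂ * |c₂| = c₂`. -/
theorem form_mvfderiv_e₁_mvfderiv_e₂ (u v : TangentSpace (𝓡 2) q) :
    prodMetric c₁ c₂ (mvfderiv (𝓡 2) (fun r ↦ mvfderiv (𝓡 2) ψ r (e₁ r)) q u)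
      (mvfderiv (𝓡 2) (fun r ↦ mvfderiv (𝓡 2) ψ r (e₂ r)) q v) =
    c₂ * S ^ 2 * (indMetric c₁ c₂ ψ q u (e₁ q) * indMetric c₁ c₂ ψ q v (e₂ q)) := by
  have dE₁ := (h.smoothMapAt_e₁ hψ hq).mdifferentiableAt
  have dE₂ := (h.smoothMapAt_e₂ hψ hq).mdifferentiableAt
  have n1 := form_mvfderiv_unitNormal_snd hψ u (mdifferentiableAt_snd dE₁)
    (.of_forall fun r ↦ (mem_prodTangent_iff.1 (hψ.mvfderiv_mem r (e₁ r))).2)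
  have n2 := form_mvfderiv_unitNormal_snd hψ v (mdifferentiableAt_snd dE₂)
    (.of_forall fun r ↦ (mem_prodTangent_iff.1 (hψ.mvfderiv_mem r (e₂ r))).2)
  rw [mvfderiv_snd dE₁] at n1
  rw [mvfderiv_snd dE₂] at n2
  have hu : form c₂ (mvfderiv (𝓡 2) ψ q u).2 (mvfderiv (𝓡 2) ψ q (e₁ q)).2 =
      indMetric c₁ c₂ ψ q u (e₁ q) := (h.prodMetric_e₁ hq _).symm
  have hv : form c₂ (mvfderiv (𝓡 2) ψ q v).2 (mvfderiv (𝓡 2) ψ q (e₂ q)).2 =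
      indMetric c₁ c₂ ψ q v (e₂ q) * S ^ 2 := by
    nth_rewrite 1 [(h.orthonormal_tangent q hq).eq_sum v]
    simp [h.form_e₁_e₂ hq, h.form_snd q hq]
  rw [hu] at n1
  rw [hv] at n2
  simp only [prodMetric, h.fst_mvfderiv_e₁ hψ hq, form_zero_left, zero_add]
  rw [h.eq_sum_snd hψ hq (w := (mvfderiv (𝓡 2) (fun r ↦ mvfderiv (𝓡 2) ψ r (e₁ r)) q u).2)]
  simp only [form_add_left, form_smul_left]
  rw [h.form_mvfderiv_e₁_e₁ hψ hq, form_comm c₂ (mvfderiv (𝓡 2) ψ q (e₂ q)).2,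
    h.form_mvfderiv_e₂_e₂_snd hψ hq, form_comm c₂ (unitNormal c₂ (ψ q).2), n1, n2]
  have h3 := Real.mul_self_sqrt (abs_nonneg c₂)
  have h4 := normalSign_mul_abs c₂
  generalize indMetric c₁ c₂ ψ q u (e₁ q) = a
  generalize indMetric c₁ c₂ ψ q v (e₂ q) = b
  linear_combination normalSign c₂ * a * b * S ^ 2 * h3 + a * b * S ^ 2 * h4

/-- `D ξ₁` lies in the first factor and has no unit normal component, because `ξ₁` is orthogonal to
the first components of all tangent vectors. It is thus a multiple of `(dψ e₂).1`, to which the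
first component of `D ξ₂` is orthogonal. -/
theorem form_mvfderiv_ξ₁_mvfderiv_ξ₂ (u v : TangentSpace (𝓡 2) q) :
    prodMetric c₁ c₂ (mvfderiv (𝓡 2) ξ₁ q u) (mvfderiv (𝓡 2) ξ₂ q v) = 0 := by
  have dE₁ := (h.smooth_normal q hq).1.mdifferentiableAt
  have n1 := form_mvfderiv_unitNormal_fst hψ u (mdifferentiableAt_fst dE₁)
    ((h.mem_nhds hq).mono fun r hr ↦ (mem_prodTangent_iff.1 (h.isNormal r hr).1.1).1)
  rw [mvfderiv_fst dE₁] at n1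
  have hu : form c₁ (mvfderiv (𝓡 2) ψ q u).1 (ξ₁ q).1 = 0 := by
    nth_rewrite 1 [(h.orthonormal_tangent q hq).eq_sum u]
    simp [h.fst_e₁ q hq, form_comm c₁ _ (ξ₁ q).1, h.form_ξ₁_e₂ hq]
  rw [hu] at n1
  simp only [prodMetric, h.snd_mvfderiv_ξ₁ hq, form_zero_left, add_zero]
  rw [h.eq_sum_fst hψ hq (w := (mvfderiv (𝓡 2) ξ₁ q u).1), h.mvfderiv_ξ₂ hψ hq]
  simp only [form_add_left, form_smul_left, form_smul_right]
  rw [h.form_mvfderiv_ξ₁_ξ₁ hq, form_comm c₁ (mvfderiv (𝓡 2) ψ q (e₂ q)).1,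
    h.form_mvfderiv_e₂_e₂_fst hψ hq, n1]
  simp

theorem hasNormalCurvatureAt : HasNormalCurvatureAt c₁ c₂ ψ q 0 := by
  intro X Y ξ η hev _ _
  have hn := (h.mem_nhds hq)
  have hR : normalCurvatureTensor c₁ c₂ ψ X Y η q = 0 := by
    obtain ⟨hX, hY, -⟩ := hev.self_of_nhds
    have := pairProj_curvature (c₁ := c₁) (c₂ := c₂) (V := η)
      (VX := fun q ↦ normalConn c₁ c₂ ψ η q (X q)) (VY := fun q ↦ normalConn c₁ c₂ ψ η q (Y q))
      (h.smooth_normal q hq).1 (h.smooth_normal q hq).2 (hn.mono h.orthonormal_normal)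
      (by filter_upwards [hn, hev] with r hr hr'
          exact ⟨(h.smooth_normal r hr).1, (h.smooth_normal r hr).2, hr'.2.2.2.1⟩)
      (by filter_upwards [hn, hev] with r hr hr'
          exact h.pairProj_eq_self hψ hr hr'.2.2.2.2.2) hX hY
      (hn.mono fun r hr ↦ h.normalConn_eq hψ hr η (X r))
      (hn.mono fun r hr ↦ h.normalConn_eq hψ hr η (Y r))
    rw [← h.normalConn_eq hψ hq, ← h.normalConn_eq hψ hq, ← h.normalConn_eq hψ hq,
      h.form_mvfderiv_ξ₁_mvfderiv_ξ₂ hψ hq, h.form_mvfderiv_ξ₁_mvfderiv_ξ₂ hψ hq] at this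
    rw [normalCurvatureTensor, this]
    simp
  rw [hR]
  simp

theorem hasGaussianCurvatureAt : HasGaussianCurvatureAt c₁ c₂ ψ q (c₂ * S ^ 2) := by
  intro X Y hev ho
  have hn := h.mem_nhds hq
  obtain ⟨hX, hY⟩ := hev.self_of_nhds
  have hconn : ∀ {r} (_ : r ∈ U) {Z W : ∀ q : M, TangentSpace (𝓡 2) q}, SmoothFieldAt Z r →
      SmoothFieldAt W r → mvfderiv (𝓡 2) ψ r (leviCivita c₁ c₂ ψ Z W r) =
        pairProj c₁ c₂ (mvfderiv (𝓡 2) ψ r (e₁ r)) (mvfderiv (𝓡 2) ψ r (e₂ r))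
          (mvfderiv (𝓡 2) (fun q ↦ mvfderiv (𝓡 2) ψ q (W q)) r (Z r)) := by
    intro r hr Z W hZ hW
    rw [hψ.leviCivita_eq hZ hW, hψ.mvfderiv_tanPart (h.orthonormal_tangent r hr)]
  have := pairProj_curvature (c₁ := c₁) (c₂ := c₂) (V := fun r ↦ mvfderiv (𝓡 2) ψ r (Y r))
    (VX := fun r ↦ mvfderiv (𝓡 2) ψ r (leviCivita c₁ c₂ ψ X Y r))
    (VY := fun r ↦ mvfderiv (𝓡 2) ψ r (leviCivita c₁ c₂ ψ Y Y r))
    (h.smoothMapAt_e₁ hψ hq) (h.smoothMapAt_e₂ hψ hq) (hn.mono h.orthonormal_tangent)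
    (by filter_upwards [hn, hev] with r hr hr'
        exact ⟨h.smoothMapAt_e₁ hψ hr, h.smoothMapAt_e₂ hψ hr,
          hr'.2.smoothMapAt (hψ.smoothMapAt r)⟩)
    (by filter_upwards [hn] with r hr
        rw [← hψ.mvfderiv_tanPart (h.orthonormal_tangent r hr), hψ.tanPart_mvfderiv]) hX hY
    (by filter_upwards [hn, hev] with r hr hr'
        exact hconn hr hr'.1 hr'.2)
    (by filter_upwards [hn, hev] with r hr hr'
        exact hconn hr hr'.2 hr'.2)
  -- Iterating the connection requires `∇_Y Y` and `∇_X Y` to be smooth fields themselves.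
  rw [← hconn hq hX (hψ.smoothFieldAt_leviCivita (hev.mono fun _ hr ↦ ⟨hr.2, hr.2⟩)),
    ← hconn hq hY (hψ.smoothFieldAt_leviCivita hev), ← hconn hq (hX.mlieBracket hY) hY,
    ← map_sub, ← map_sub, h.form_mvfderiv_e₁_mvfderiv_e₂ hψ hq,
    h.form_mvfderiv_e₁_mvfderiv_e₂ hψ hq] at this
  change prodMetric c₁ c₂ (mvfderiv (𝓡 2) ψ q (curvature c₁ c₂ ψ X Y Y q)) _ = _
  rw [curvature, this, prodMetric_smul_left, sub_eq_add_neg, sub_eq_add_neg, prodMetric_add_left,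
    prodMetric_neg_left, prodMetric_smul_left, prodMetric_smul_left]
  change (c₂ * S ^ 2 * (indMetric c₁ c₂ ψ q (Y q) (e₁ q) * indMetric c₁ c₂ ψ q (X q) (e₂ q)) +
    -(c₂ * S ^ 2 * (indMetric c₁ c₂ ψ q (X q) (e₁ q) * indMetric c₁ c₂ ψ q (Y q) (e₂ q)))) *
    (indMetric c₁ c₂ ψ q (Y q) (e₁ q) * indMetric c₁ c₂ ψ q (e₂ q) (X q) +
    -(indMetric c₁ c₂ ψ q (Y q) (e₂ q) * indMetric c₁ c₂ ψ q (e₁ q) (X q))) = _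
  rw [indMetric_comm (e₂ q), indMetric_comm (e₁ q)]
  have hex := (h.orthonormal_tangent q hq)
  obtain ⟨o1, o2, o3⟩ := ho
  rw [hex.eq_sum (X q), hex.eq_sum (Y q)] at o3
  rw [hex.eq_sum (X q)] at o1
  rw [hex.eq_sum (Y q)] at o2
  simp only [indMetric_add_left, indMetric_add_right, indMetric_smul_left, indMetric_smul_right,
    hex.1, hex.2.1, hex.2.2, indMetric_comm (e₂ q) (e₁ q)] at o1 o2 o3
  generalize indMetric c₁ c₂ ψ q (X q) (e₁ q) = x₁ at *
  generalize indMetric c₁ c₂ ψ q (X q) (e₂ q) = x₂ at *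
  generalize indMetric c₁ c₂ ψ q (Y q) (e₁ q) = y₁ at *
  generalize indMetric c₁ c₂ ψ q (Y q) (e₂ q) = y₂ at *
  -- The change of orthonormal basis from `e₁, e₂` to `X, Y` has determinant `±1`, so the curvature
  -- does not depend on the pair.
  have hdet : (y₁ * x₂ - x₁ * y₂) ^ 2 = 1 := by
    have o1' : x₁ ^ 2 + x₂ ^ 2 = 1 := by linarith
    have o2' : y₁ ^ 2 + y₂ ^ 2 = 1 := by linarith
    have o3' : x₁ * y₁ + x₂ * y₂ = 0 := by linarith
    linear_combination (y₁ ^ 2 + y₂ ^ 2) * o1' + o2' - (x₁ * y₁ + x₂ * y₂) * o3'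
  linear_combination c₂ * S ^ 2 * hdet

end IsSpecialFrame

end ConstantAngle

end

/-! ### Existence of the special frame. -/

noncomputable section

namespace ConstantAngle

variable {M : Type*} [TopologicalSpace M] [ChartedSpace (EuclideanSpace ℝ (Fin 2)) M]
  {c₁ c₂ : ℝ} {ψ : M → Amb × Amb} {q : M}

section fTensor

variable (hψ : IsImmersedSurface c₁ c₂ ψ)
include hψ

theorem IsImmersedSurface.fTensor_add (u v : TangentSpace (𝓡 2) q) :
    fTensor c₁ c₂ ψ q (u + v) = fTensor c₁ c₂ ψ q u + fTensor c₁ c₂ ψ q v := by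
  rw [fTensor, fTensor, fTensor, ← hψ.tanPart_add, map_add]
  exact congrArg _ (Prod.ext rfl (neg_add _ _))

theorem IsImmersedSurface.fTensor_smul (a : ℝ) (u : TangentSpace (𝓡 2) q) :
    fTensor c₁ c₂ ψ q (a • u) = a • fTensor c₁ c₂ ψ q u := by
  rw [fTensor, fTensor, ← hψ.tanPart_smul, map_smul]
  exact congrArg _ (Prod.ext rfl (smul_neg _ _).symm)

theorem IsImmersedSurface.indMetric_fTensor (u v : TangentSpace (𝓡 2) q) :
    indMetric c₁ c₂ ψ q (fTensor c₁ c₂ ψ q u) v =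
      prodMetric c₁ c₂ (prodStructure (mvfderiv (𝓡 2) ψ q u)) (mvfderiv (𝓡 2) ψ q v) :=
  hψ.indMetric_tanPart _ _

theorem IsImmersedSurface.indMetric_fTensor_comm (u v : TangentSpace (𝓡 2) q) :
    indMetric c₁ c₂ ψ q (fTensor c₁ c₂ ψ q u) v = indMetric c₁ c₂ ψ q u (fTensor c₁ c₂ ψ q v) := by
  rw [indMetric_comm u, hψ.indMetric_fTensor, hψ.indMetric_fTensor,
    prodMetric_prodStructure_left, prodMetric_comm]

/-- This is `(f - l₁)(f - l₂) = 0`: each factor maps into the eigenspace of the other eigenvalue,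
which turns arbitrary smooth fields into smooth eigenfields. -/
theorem IsImmersedSurface.fTensor_fTensor_sub {l₁ l₂ : ℝ}
    (h : HasPrincipalValuesAt c₁ c₂ ψ q l₁ l₂) (w : TangentSpace (𝓡 2) q) :
    fTensor c₁ c₂ ψ q (fTensor c₁ c₂ ψ q w + (-l₂) • w) =
      l₁ • (fTensor c₁ c₂ ψ q w + (-l₂) • w) ∧
    fTensor c₁ c₂ ψ q (fTensor c₁ c₂ ψ q w + (-l₁) • w) =
      l₂ • (fTensor c₁ c₂ ψ q w + (-l₁) • w) := by
  obtain ⟨-, b, h0, h1⟩ := h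
  have hw := b.sum_repr w
  rw [Fin.sum_univ_two] at hw
  rw [← hw]
  simp only [hψ.fTensor_add, hψ.fTensor_smul, h0, h1]
  constructor <;> module

end fTensor

theorem SmoothFieldAt.normalize [IsManifold (𝓡 2) ∞ M] (hψ : IsImmersedSurface c₁ c₂ ψ)
    {X : ∀ q : M, TangentSpace (𝓡 2) q} (hX : SmoothFieldAt X q)
    (hpos : 0 < indMetric c₁ c₂ ψ q (X q) (X q)) :
    SmoothFieldAt (fun r ↦ (√(indMetric c₁ c₂ ψ r (X r) (X r)))⁻¹ • X r) q := by
  have h1 : ContMDiffAt (𝓡 2) 𝓘(ℝ, ℝ) ∞ (fun r ↦ indMetric c₁ c₂ ψ r (X r) (X r)) q :=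
    (hX.smoothMapAt (hψ.smoothMapAt q)).prodMetric (hX.smoothMapAt (hψ.smoothMapAt q))
  have h2 : ContMDiffAt (𝓡 2) 𝓘(ℝ, ℝ) ∞ (fun r ↦ √(indMetric c₁ c₂ ψ r (X r) (X r))) q :=
    (Real.contDiffAt_sqrt (n := ∞) hpos.ne').contMDiffAt.comp q h1
  exact SmoothFieldAt.smul (h2.inv₀ (Real.sqrt_pos.2 hpos).ne') hX

/-- A smooth orthonormal frame of eigenvectors of `f` with distinct constant eigenvalues. -/
theorem IsImmersedSurface.exists_eigenframe [IsManifold (𝓡 2) ∞ M]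
    (hψ : IsImmersedSurface c₁ c₂ ψ) {l₁ l₂ : ℝ} (hl : l₁ < l₂)
    (h : ∀ p, HasPrincipalValuesAt c₁ c₂ ψ p l₁ l₂) (p : M) :
    ∃ U : Set M, IsOpen U ∧ p ∈ U ∧ ∃ e₁ e₂ : ∀ q : M, TangentSpace (𝓡 2) q, ∀ q ∈ U,
      SmoothFieldAt e₁ q ∧ SmoothFieldAt e₂ q ∧ TanOrthonormal c₁ c₂ ψ q (e₁ q) (e₂ q) ∧
      fTensor c₁ c₂ ψ q (e₁ q) = l₁ • e₁ q ∧ fTensor c₁ c₂ ψ q (e₂ q) = l₂ • e₂ q := by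
  obtain ⟨-, b, h0, h1⟩ := h p
  obtain ⟨U₁, hU₁, hp₁, X₁, hX₁, hXp₁⟩ := exists_smooth_extension p (b 0)
  obtain ⟨U₂, hU₂, hp₂, X₂, hX₂, hXp₂⟩ := exists_smooth_extension p (b 1)
  let Y₁ (q : M) : TangentSpace (𝓡 2) q := fTensor c₁ c₂ ψ q (X₁ q) + (-l₂) • X₁ q
  let Y₂ (q : M) : TangentSpace (𝓡 2) q := fTensor c₁ c₂ ψ q (X₂ q) + (-l₁) • X₂ q
  have hf : ∀ {q : M} {X : ∀ q : M, TangentSpace (𝓡 2) q}, SmoothFieldAt X q →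
      SmoothFieldAt (fun q ↦ fTensor c₁ c₂ ψ q (X q)) q := by
    intro q X hX
    have hF := hX.smoothMapAt (hψ.smoothMapAt q)
    exact hψ.smoothFieldAt_tanPart ((((ContinuousLinearMap.fst ℝ Amb Amb).prod
      (-ContinuousLinearMap.snd ℝ Amb Amb))).contMDiff.contMDiffAt.comp q hF)
  have hY₁ : ∀ q ∈ U₁ ∩ U₂, SmoothFieldAt Y₁ q := fun q hq ↦
    (hf (hX₁ q hq.1)).add ((hX₁ q hq.1).smul contMDiffAt_const)
  have hY₂ : ∀ q ∈ U₁ ∩ U₂, SmoothFieldAt Y₂ q := fun q hq ↦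
    (hf (hX₂ q hq.2)).add ((hX₂ q hq.2).smul contMDiffAt_const)
  have hcont : ∀ {Y : ∀ q : M, TangentSpace (𝓡 2) q}, (∀ q ∈ U₁ ∩ U₂, SmoothFieldAt Y q) →
      ContinuousOn (fun q ↦ indMetric c₁ c₂ ψ q (Y q) (Y q)) (U₁ ∩ U₂) := by
    intro Y hY q hq
    have h1 := (hY q hq).smoothMapAt (hψ.smoothMapAt q)
    exact (h1.prodMetric (c₁ := c₁) (c₂ := c₂) h1).continuousAt.continuousWithinAt
  have hpos : ∀ {Y : ∀ q : M, TangentSpace (𝓡 2) q} (_ : Y p ≠ 0),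
      0 < indMetric c₁ c₂ ψ p (Y p) (Y p) := fun h ↦ hψ.indMetric_self_pos h
  have hU₀ := hU₁.inter hU₂
  -- At `p` the eigenfields are nonzero multiples of the eigenbasis, since `l₁ ≠ l₂`; the
  -- neighbourhood is where they stay nonzero and can be normalised.
  refine ⟨(U₁ ∩ U₂ ∩ (fun q ↦ indMetric c₁ c₂ ψ q (Y₁ q) (Y₁ q)) ⁻¹' Set.Ioi 0) ∩
    (U₁ ∩ U₂ ∩ (fun q ↦ indMetric c₁ c₂ ψ q (Y₂ q) (Y₂ q)) ⁻¹' Set.Ioi 0),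
    ((hcont hY₁).isOpen_inter_preimage hU₀ isOpen_Ioi).inter
    ((hcont hY₂).isOpen_inter_preimage hU₀ isOpen_Ioi), ⟨⟨⟨hp₁, hp₂⟩, hpos ?_⟩, ⟨hp₁, hp₂⟩, hpos ?_⟩,
    fun q ↦ (√(indMetric c₁ c₂ ψ q (Y₁ q) (Y₁ q)))⁻¹ • Y₁ q,
    fun q ↦ (√(indMetric c₁ c₂ ψ q (Y₂ q) (Y₂ q)))⁻¹ • Y₂ q, ?_⟩
  · simp only [Y₁, hXp₁, h0, ← add_smul]
    exact smul_ne_zero (by linarith) (b.ne_zero 0)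
  · simp only [Y₂, hXp₂, h1, ← add_smul]
    exact smul_ne_zero (by linarith) (b.ne_zero 1)
  · rintro q ⟨⟨hq, hpos₁⟩, -, hpos₂⟩
    replace hpos₁ : 0 < indMetric c₁ c₂ ψ q (Y₁ q) (Y₁ q) := hpos₁
    replace hpos₂ : 0 < indMetric c₁ c₂ ψ q (Y₂ q) (Y₂ q) := hpos₂
    have hf₁ : fTensor c₁ c₂ ψ q (Y₁ q) = l₁ • Y₁ q := (hψ.fTensor_fTensor_sub (h q) _).1
    have hf₂ : fTensor c₁ c₂ ψ q (Y₂ q) = l₂ • Y₂ q := (hψ.fTensor_fTensor_sub (h q) _).2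
    have horth : indMetric c₁ c₂ ψ q (Y₁ q) (Y₂ q) = 0 := by
      have := hψ.indMetric_fTensor_comm (Y₁ q) (Y₂ q)
      rw [hf₁, hf₂, indMetric_smul_left, indMetric_smul_right] at this
      have h3 : (l₁ - l₂) * indMetric c₁ c₂ ψ q (Y₁ q) (Y₂ q) = 0 := by linarith
      exact (mul_eq_zero.1 h3).resolve_left (by linarith)
    have hn : ∀ x : ℝ, 0 < x → (√x)⁻¹ * ((√x)⁻¹ * x) = 1 := by
      intro x hx
      have h1 := Real.mul_self_sqrt hx.le
      have h2 := (Real.sqrt_pos.2 hx).ne'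
      field_simp
      linarith
    refine ⟨(hY₁ q hq).normalize hψ hpos₁, (hY₂ q hq).normalize hψ hpos₂, ⟨?_, ?_, ?_⟩, ?_, ?_⟩
    · simp [hn _ hpos₁]
    · simp [hn _ hpos₂]
    · simp [horth]
    · rw [hψ.fTensor_smul, hf₁, smul_comm]
    · rw [hψ.fTensor_smul, hf₂, smul_comm]

theorem IsImmersedSurface.exists_isSpecialFrame [IsManifold (𝓡 2) ∞ M]
    (hψ : IsImmersedSurface c₁ c₂ ψ) {C S : ℝ} (hC : 0 < C) (hS : 0 < S)
    (hsq : C ^ 2 + S ^ 2 = 1) (h : ∀ p, HasPrincipalValuesAt c₁ c₂ ψ p (-1) (C ^ 2 - S ^ 2))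
    (p : M) : ∃ U : Set M, p ∈ U ∧ ∃ (e₁ e₂ : ∀ q : M, TangentSpace (𝓡 2) q)
      (ξ₁ ξ₂ : M → Amb × Amb), IsSpecialFrame c₁ c₂ ψ C S U e₁ e₂ ξ₁ ξ₂ := by
  obtain ⟨U, hU, hp, e₁, e₂, hfr⟩ := hψ.exists_eigenframe (by nlinarith [sq_pos_of_pos hC]) h p
  -- The squared lengths of the two components of `dψ e₁` have sum `1` and difference `-1`. The
  -- first is therefore zero, and the form is definite on the tangent plane.
  have hfst : ∀ q ∈ U, (mvfderiv (𝓡 2) ψ q (e₁ q)).1 = 0 := by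
    intro q hq
    obtain ⟨-, -, ho, hf, -⟩ := hfr q hq
    have h1 := hψ.indMetric_fTensor (e₁ q) (e₁ q)
    have h2 := ho.1
    rw [hf, indMetric_smul_left, h2] at h1
    simp only [indMetric, prodMetric, prodStructure, form_neg_left] at h1 h2
    by_contra hne
    have := form_self_pos (hψ.mem q).1 (mem_prodTangent_iff.1 (hψ.mvfderiv_mem q (e₁ q))).1 hne
    linarith
  have hn : ∀ q ∈ U,
      form c₁ (mvfderiv (𝓡 2) ψ q (e₂ q)).1 (mvfderiv (𝓡 2) ψ q (e₂ q)).1 = C ^ 2 ∧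
      form c₂ (mvfderiv (𝓡 2) ψ q (e₂ q)).2 (mvfderiv (𝓡 2) ψ q (e₂ q)).2 = S ^ 2 := by
    intro q hq
    obtain ⟨-, -, ho, -, hf⟩ := hfr q hq
    have h1 := hψ.indMetric_fTensor (e₂ q) (e₂ q)
    have h2 := ho.2.1
    rw [hf, indMetric_smul_left, h2] at h1
    simp only [indMetric, prodMetric, prodStructure, form_neg_left] at h1 h2
    constructor <;> linarith
  have h12 : ∀ q ∈ U,
      form c₂ (mvfderiv (𝓡 2) ψ q (e₂ q)).2 (mvfderiv (𝓡 2) ψ q (e₁ q)).2 = 0 := by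
    intro q hq
    have := (hfr q hq).2.2.1.2.2
    rw [indMetric_comm] at this
    simpa [indMetric, prodMetric, hfst q hq] using this
  have hx : ∀ q, form c₁ (unitNormal c₁ (ψ q).1) (mvfderiv (𝓡 2) ψ q (e₂ q)).1 = 0 ∧
      form c₂ (unitNormal c₂ (ψ q).2) (mvfderiv (𝓡 2) ψ q (e₂ q)).2 = 0 := fun q ↦
    mem_prodTangent_iff.1 (hψ.mvfderiv_mem q (e₂ q))
  have hcr : ∀ u v, form c₁ (cross c₁ u v) v = 0 := fun u v ↦ by
    rw [form_comm, form_cross_right]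
  have hs := normalSign_sq c₁
  -- The cross product with the unit normal rotates the first component of `dψ e₂` by a right angle
  -- in its tangent plane. In `ξ₂` the ratios `S / C` and `-(C / S)` give orthogonality to `e₂` and
  -- unit length.
  refine ⟨U, hp, e₁, e₂, fun q ↦ (C⁻¹ • cross c₁ (unitNormal c₁ (ψ q).1)
    (mvfderiv (𝓡 2) ψ q (e₂ q)).1, 0), fun q ↦ ((S / C) • (mvfderiv (𝓡 2) ψ q (e₂ q)).1,
    -((C / S) • (mvfderiv (𝓡 2) ψ q (e₂ q)).2)), ?_⟩
  refine
    { smooth_tangent := fun q hq ↦ ⟨(hfr q hq).1, (hfr q hq).2.1⟩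
      smooth_normal := fun q hq ↦ ?_
      isNormal := fun q hq ↦ ⟨⟨mem_prodTangent_iff.2 ⟨?_, ?_⟩, fun w ↦ ?_⟩,
        ⟨mem_prodTangent_iff.2 ⟨?_, ?_⟩, fun w ↦ ?_⟩⟩
      orthonormal_tangent := fun q hq ↦ (hfr q hq).2.2.1
      orthonormal_normal := fun q hq ↦ ⟨?_, ?_, ?_⟩
      isOpen := hU
      pos_C := hC
      pos_S := hS
      sq_add_sq := hsq
      fst_e₁ := hfst
      snd_ξ₁ := fun q hq ↦ rfl
      ξ₂_eq := fun q hq ↦ rfl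
      form_fst := fun q hq ↦ (hn q hq).1
      form_snd := fun q hq ↦ (hn q hq).2 }
  · have hE := (hfr q hq).2.1.smoothMapAt (hψ.smoothMapAt q)
    have hN := contMDiffAt_unitNormal c₁ (contMDiffAt_fst (hψ.smoothMapAt q))
    refine ⟨contMDiffAt_pair ?_ contMDiffAt_const, ?_⟩
    · exact (C⁻¹ • ContinuousLinearMap.id ℝ Amb).contMDiff.contMDiffAt.comp q
        ((contDiff_cross c₁).contMDiff.contMDiffAt.comp q (contMDiffAt_pair hN (contMDiffAt_fst hE)))
    · exact (((S / C) • ContinuousLinearMap.fst ℝ Amb Amb).prod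
        (-((C / S) • ContinuousLinearMap.snd ℝ Amb Amb))).contMDiff.contMDiffAt.comp q hE
  · simp [form_cross_left]
  · simp
  · rw [(hfr q hq).2.2.1.eq_sum w]
    simp [prodMetric, hfst q hq, hcr]
  · simp [(hx q).1]
  · simp [(hx q).2]
  · rw [(hfr q hq).2.2.1.eq_sum w]
    simp [prodMetric, hfst q hq, h12 q hq, hn q hq]
    field_simp
    ring
  · simp only [prodMetric, form_smul_left, form_smul_right, form_zero_left, add_zero,
      form_cross_self, (hx q).1, (hn q hq).1, form_unitNormal_self (hψ.mem q).1]
    field_simp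
    linear_combination C ^ 2 * hs
  · simp [prodMetric, hn q hq]
    field_simp
    linarith
  · simp [prodMetric, hcr]

end ConstantAngle

end

noncomputable section

namespace ConstantAngle

/-! ### Interchanging the two factors -/

section Swap

variable {M : Type*} [TopologicalSpace M] [ChartedSpace (EuclideanSpace ℝ (Fin 2)) M]
  {c₁ c₂ : ℝ} {ψ : M → Amb × Amb} {p : M}

/-- Interchange of the two factors as a continuous linear map. -/
def swapCLM : Amb × Amb →L[ℝ] Amb × Amb :=
  (ContinuousLinearMap.snd ℝ Amb Amb).prod (ContinuousLinearMap.fst ℝ Amb Amb)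

theorem mdifferentiableAt_swap {V : M → Amb × Amb}
    (hV : MDifferentiableAt (𝓡 2) 𝓘(ℝ, Amb × Amb) V p) :
    MDifferentiableAt (𝓡 2) 𝓘(ℝ, Amb × Amb) (fun q ↦ (V q).swap) p :=
  (swapCLM.mdifferentiableAt (x := V p)).comp p hV

/-- No differentiability is assumed: when `V` is not differentiable neither is its swap, and both
derivatives take the default value zero. The transfer lemmas below are therefore unconditional
wherever possible. -/
theorem mvfderiv_swap (V : M → Amb × Amb) (p : M) (u : TangentSpace (𝓡 2) p) :
    mvfderiv (𝓡 2) (fun q ↦ (V q).swap) p u = (mvfderiv (𝓡 2) V p u).swap := by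
  by_cases hV : MDifferentiableAt (𝓡 2) 𝓘(ℝ, Amb × Amb) V p
  · exact mvfderiv_clm_comp swapCLM hV u
  · have hV' : ¬ MDifferentiableAt (𝓡 2) 𝓘(ℝ, Amb × Amb) (fun q ↦ (V q).swap) p :=
      fun h ↦ hV (mdifferentiableAt_swap h)
    rw [mvfderiv, mvfderiv, mfderiv_zero_of_not_mdifferentiableAt hV,
      mfderiv_zero_of_not_mdifferentiableAt hV']
    rfl

theorem prodMetric_swap (v w : Amb × Amb) :
    prodMetric c₂ c₁ v.swap w.swap = prodMetric c₁ c₂ v w := add_comm _ _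

theorem ambOrthonormal_swap_iff {v w : Amb × Amb} :
    AmbOrthonormal c₂ c₁ v.swap w.swap ↔ AmbOrthonormal c₁ c₂ v w := by
  simp only [AmbOrthonormal, prodMetric_swap]

theorem prodStructure_swap (v : Amb × Amb) :
    prodStructure v.swap = -(prodStructure v).swap := by
  ext1 <;> simp [prodStructure]

theorem IsImmersedSurface.swap (hψ : IsImmersedSurface c₁ c₂ ψ) :
    IsImmersedSurface c₂ c₁ (fun q ↦ (ψ q).swap) where
  smooth := swapCLM.contMDiff.comp hψ.smooth
  mem q := (hψ.mem q).symm
  injective q u v huv := by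
    rw [mvfderiv_swap, mvfderiv_swap] at huv
    exact hψ.injective q (Prod.swap_injective huv)

theorem indMetric_swap : indMetric c₂ c₁ (fun q ↦ (ψ q).swap) = indMetric c₁ c₂ ψ := by
  funext q u v
  simp only [indMetric, mvfderiv_swap, prodMetric_swap]

theorem tanPart_swap (v : Amb × Amb) :
    tanPart c₂ c₁ (fun q ↦ (ψ q).swap) p v.swap = tanPart c₁ c₂ ψ p v := by
  simp only [tanPart, indMetric_swap, mvfderiv_swap, prodMetric_swap]

theorem norPart_swap (v : Amb × Amb) :
    norPart c₂ c₁ (fun q ↦ (ψ q).swap) p v.swap = (norPart c₁ c₂ ψ p v).swap := by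
  rw [norPart, tanPart_swap, mvfderiv_swap]
  rfl

theorem isNormal_swap_iff {v : Amb × Amb} :
    IsNormal c₂ c₁ (fun q ↦ (ψ q).swap) p v.swap ↔ IsNormal c₁ c₂ ψ p v := by
  simp only [IsNormal, mvfderiv_swap, prodMetric_swap, mem_prodTangent_iff, Prod.fst_swap,
    Prod.snd_swap, and_comm]

theorem ambConn_swap (V : M → Amb × Amb) (u : TangentSpace (𝓡 2) p) :
    ambConn c₂ c₁ (fun q ↦ (ψ q).swap) (fun q ↦ (V q).swap) p u =
      (ambConn c₁ c₂ ψ V p u).swap := by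
  rw [ambConn, mvfderiv_swap]
  rfl

theorem shapeOp_swap (ξ : M → Amb × Amb) (u : TangentSpace (𝓡 2) p) :
    shapeOp c₂ c₁ (fun q ↦ (ψ q).swap) (fun q ↦ (ξ q).swap) p u = shapeOp c₁ c₂ ψ ξ p u := by
  rw [shapeOp, shapeOp, ambConn_swap, tanPart_swap]

theorem normalConn_swap (ξ : M → Amb × Amb) (u : TangentSpace (𝓡 2) p) :
    normalConn c₂ c₁ (fun q ↦ (ψ q).swap) (fun q ↦ (ξ q).swap) p u =
      (normalConn c₁ c₂ ψ ξ p u).swap := by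
  rw [normalConn, normalConn, ambConn_swap, norPart_swap]

theorem normalCurvatureTensor_swap (X Y : ∀ q : M, TangentSpace (𝓡 2) q) (ξ : M → Amb × Amb) :
    normalCurvatureTensor c₂ c₁ (fun q ↦ (ψ q).swap) X Y (fun q ↦ (ξ q).swap) p =
      (normalCurvatureTensor c₁ c₂ ψ X Y ξ p).swap := by
  simp only [normalCurvatureTensor, normalConn_swap]
  rfl

theorem IsImmersedSurface.tanPart_neg (hψ : IsImmersedSurface c₁ c₂ ψ) (v : Amb × Amb) :
    tanPart c₁ c₂ ψ p (-v) = -tanPart c₁ c₂ ψ p v := by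
  simpa using hψ.tanPart_smul (p := p) (-1) v

theorem IsImmersedSurface.norPart_neg (hψ : IsImmersedSurface c₁ c₂ ψ) (v : Amb × Amb) :
    norPart c₁ c₂ ψ p (-v) = -norPart c₁ c₂ ψ p v := by
  rw [norPart, norPart, hψ.tanPart_neg, map_neg]; abel

/-- The product structure changes sign when the factors are interchanged, so the eigenvalues of `f`
change sign and order. -/
theorem IsImmersedSurface.fTensor_swap (hψ : IsImmersedSurface c₁ c₂ ψ)
    (u : TangentSpace (𝓡 2) p) :
    fTensor c₂ c₁ (fun q ↦ (ψ q).swap) p u = -fTensor c₁ c₂ ψ p u := by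
  rw [fTensor, mvfderiv_swap, prodStructure_swap, ← Prod.swap_neg, tanPart_swap, hψ.tanPart_neg,
    fTensor]

theorem IsImmersedSurface.tTensor_swap (hψ : IsImmersedSurface c₁ c₂ ψ) (v : Amb × Amb) :
    tTensor c₂ c₁ (fun q ↦ (ψ q).swap) p v.swap = -(tTensor c₁ c₂ ψ p v).swap := by
  rw [tTensor, prodStructure_swap, ← Prod.swap_neg, norPart_swap, hψ.norPart_neg, tTensor,
    Prod.swap_neg]

theorem HasPrincipalValuesAt.swap (hψ : IsImmersedSurface c₁ c₂ ψ) {l₁ l₂ : ℝ}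
    (h : HasPrincipalValuesAt c₁ c₂ ψ p l₁ l₂) :
    HasPrincipalValuesAt c₂ c₁ (fun q ↦ (ψ q).swap) p (-l₂) (-l₁) := by
  obtain ⟨hl, b, h0, h1⟩ := h
  refine ⟨neg_le_neg hl, b.reindex (Equiv.swap 0 1), ?_, ?_⟩
  · simp [hψ.fTensor_swap, h1]
  · simp [hψ.fTensor_swap, h0]

variable [IsManifold (𝓡 2) ∞ M]

omit [IsManifold (𝓡 2) ∞ M] in
theorem SmoothMapAt.swap {V : M → Amb × Amb} (hV : SmoothMapAt V p) :
    SmoothMapAt (fun q ↦ (V q).swap) p :=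
  swapCLM.contMDiff.contMDiffAt.comp p hV

/-- The Koszul formula involves only the induced metric, which the swap preserves. -/
theorem leviCivita_swap : leviCivita c₂ c₁ (fun q ↦ (ψ q).swap) = leviCivita c₁ c₂ ψ := by
  funext X Y q
  simp only [leviCivita, indMetric_swap]

theorem HasGaussianCurvatureAt.of_swap {κ : ℝ}
    (h : HasGaussianCurvatureAt c₂ c₁ (fun q ↦ (ψ q).swap) p κ) :
    HasGaussianCurvatureAt c₁ c₂ ψ p κ := by
  simpa only [HasGaussianCurvatureAt, curvature, leviCivita_swap, indMetric_swap,
    TanOrthonormal] using h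

theorem HasNormalCurvatureAt.of_swap {κ : ℝ}
    (h : HasNormalCurvatureAt c₂ c₁ (fun q ↦ (ψ q).swap) p κ) :
    HasNormalCurvatureAt c₁ c₂ ψ p κ := by
  intro X Y ξ η hev ho hn
  rw [← h X Y (fun q ↦ (ξ q).swap) (fun q ↦ (η q).swap) ?_ ?_ (ambOrthonormal_swap_iff.2 hn),
    normalCurvatureTensor_swap, prodMetric_swap]
  · filter_upwards [hev] with r hr
    exact ⟨hr.1, hr.2.1, hr.2.2.1.swap, hr.2.2.2.1.swap, isNormal_swap_iff.2 hr.2.2.2.2.1,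
      isNormal_swap_iff.2 hr.2.2.2.2.2⟩
  · simpa only [TanOrthonormal, indMetric_swap] using ho

end Swap

/-! ### Smooth coefficients and the formulas of case (1). -/

section Conclusion

variable {M : Type*} [TopologicalSpace M] [ChartedSpace (EuclideanSpace ℝ (Fin 2)) M]
  [IsManifold (𝓡 2) ∞ M] {c₁ c₂ : ℝ} {ψ : M → Amb × Amb} {C S : ℝ} {U : Set M}
  {e₁ e₂ : ∀ q : M, TangentSpace (𝓡 2) q} {ξ₁ ξ₂ : M → Amb × Amb}

/-- The eigenvalue of the shape operator of `ξ₁` on `e₂`. -/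
def shapeCoeff₁ (c₁ : ℝ) (ψ : M → Amb × Amb) (e₂ : ∀ q : M, TangentSpace (𝓡 2) q)
    (ξ₁ : M → Amb × Amb) (q : M) : ℝ :=
  -form c₁ (mvfderiv (𝓡 2) ξ₁ q (e₂ q)).1 (mvfderiv (𝓡 2) ψ q (e₂ q)).1

/-- The eigenvalue of the shape operator of `ξ₂` on `e₁`. -/
def shapeCoeff₂ (c₂ C S : ℝ) (ψ : M → Amb × Amb) (e₁ e₂ : ∀ q : M, TangentSpace (𝓡 2) q)
    (q : M) : ℝ :=
  -(C / S) * form c₂ (mvfderiv (𝓡 2) (fun r ↦ mvfderiv (𝓡 2) ψ r (e₁ r)) q (e₁ q)).2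
      (mvfderiv (𝓡 2) ψ q (e₂ q)).2

namespace IsSpecialFrame

variable (h : IsSpecialFrame c₁ c₂ ψ C S U e₁ e₂ ξ₁ ξ₂) (hψ : IsImmersedSurface c₁ c₂ ψ)
include h hψ

theorem contMDiffOn_shapeCoeff₁ :
    ContMDiffOn (𝓡 2) 𝓘(ℝ, ℝ) ∞ (shapeCoeff₁ c₁ ψ e₂ ξ₁) U := fun q hq ↦
  (SmoothMapAt.form (contMDiffAt_fst ((h.smooth_tangent q hq).2.smoothMapAt
    (h.smooth_normal q hq).1)) (contMDiffAt_fst (h.smoothMapAt_e₂ hψ hq))).neg.contMDiffWithinAt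

theorem contMDiffOn_shapeCoeff₂ :
    ContMDiffOn (𝓡 2) 𝓘(ℝ, ℝ) ∞ (shapeCoeff₂ c₂ C S ψ e₁ e₂) U := fun q hq ↦
  (contMDiffAt_const.mul (SmoothMapAt.form (contMDiffAt_snd ((h.smooth_tangent q hq).1.smoothMapAt
    (h.smoothMapAt_e₁ hψ hq))) (contMDiffAt_snd (h.smoothMapAt_e₂ hψ hq)))).contMDiffWithinAt

theorem hasSpecialShape : HasSpecialShape c₁ c₂ ψ U e₁ e₂ ξ₁ ξ₂
    (shapeCoeff₁ c₁ ψ e₂ ξ₁) (shapeCoeff₂ c₂ C S ψ e₁ e₂) := by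
  intro q hq
  simp only [h.shapeOp_ξ₁ hψ hq, h.shapeOp_ξ₂ hψ hq, h.form_mvfderiv_ξ₁_e₁ hψ hq,
    h.form_mvfderiv_e₁_e₂ hψ hq, shapeCoeff₁, shapeCoeff₂]
  simp

/-- The second formula, with `e₁` and `e₂` exchanged, serves case (2), where their roles are
interchanged. -/
theorem connection_eq {q : M} (hq : q ∈ U) {X : ∀ q : M, TangentSpace (𝓡 2) q}
    (hX : SmoothFieldAt X q) :
    indMetric c₁ c₂ ψ q (leviCivita c₁ c₂ ψ X e₁ q) (e₂ q) =
      -(S / C) * shapeCoeff₂ c₂ C S ψ e₁ e₂ q * indMetric c₁ c₂ ψ q (X q) (e₁ q) ∧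
    indMetric c₁ c₂ ψ q (leviCivita c₁ c₂ ψ X e₂ q) (e₁ q) =
      S / C * shapeCoeff₂ c₂ C S ψ e₁ e₂ q * indMetric c₁ c₂ ψ q (X q) (e₁ q) := by
  have hC := h.pos_C.ne'
  have hS := h.pos_S.ne'
  rw [(h.indMetric_leviCivita hψ hq hX).1, (h.indMetric_leviCivita hψ hq hX).2,
    h.form_mvfderiv_e₁_eq hψ hq (X q), shapeCoeff₂]
  constructor <;> field_simp

theorem normalConnection_eq {q : M} (hq : q ∈ U) (u : TangentSpace (𝓡 2) q) :
    prodMetric c₁ c₂ (normalConn c₁ c₂ ψ ξ₁ q u) (ξ₂ q) =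
      -(S / C) * shapeCoeff₁ c₁ ψ e₂ ξ₁ q * indMetric c₁ c₂ ψ q u (e₂ q) ∧
    prodMetric c₁ c₂ (normalConn c₁ c₂ ψ ξ₂ q u) (ξ₁ q) =
      S / C * shapeCoeff₁ c₁ ψ e₂ ξ₁ q * indMetric c₁ c₂ ψ q u (e₂ q) := by
  rw [(h.prodMetric_normalConn hψ hq u).1, (h.prodMetric_normalConn hψ hq u).2,
    h.form_mvfderiv_ξ₁_eq hψ hq u, shapeCoeff₁]
  constructor <;> ring

end IsSpecialFrame

/-- For an angle in `[0, π/2]` whose double is not a multiple of `π`, sine and cosine are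
positive. -/
theorem cos_pos_and_sin_pos {θ : ℝ} (hθ : θ ∈ Set.Icc 0 (Real.pi / 2))
    (h : Real.cos (2 * θ) ∈ Set.Ioo (-1 : ℝ) 1) : 0 < Real.cos θ ∧ 0 < Real.sin θ := by
  have hc : 0 ≤ Real.cos θ := Real.cos_nonneg_of_mem_Icc ⟨by linarith [hθ.1, Real.pi_pos], hθ.2⟩
  have hs : 0 ≤ Real.sin θ := Real.sin_nonneg_of_mem_Icc ⟨hθ.1, by linarith [hθ.2, Real.pi_pos]⟩
  have h1 := Real.cos_two_mul' θ
  have h2 := Real.sin_sq_add_cos_sq θ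
  refine ⟨hc.lt_of_ne fun h0 ↦ ?_, hs.lt_of_ne fun h0 ↦ ?_⟩
  · rw [← h0] at h1 h2; linarith [h.1]
  · rw [← h0] at h1 h2; linarith [h.2]

end Conclusion

end ConstantAngle

end

/-! ### Transport of the special frame to the interchanged product for case (2). -/

noncomputable section

namespace ConstantAngle

section SwappedFrame

variable {M : Type*} [TopologicalSpace M] [ChartedSpace (EuclideanSpace ℝ (Fin 2)) M]
  {c₁ c₂ : ℝ} {ψ : M → Amb × Amb}

theorem IsNormal.neg {p : M} {v : Amb × Amb} (hv : IsNormal c₁ c₂ ψ p v) :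
    IsNormal c₁ c₂ ψ p (-v) := by
  refine ⟨⟨?_, ?_⟩, fun w ↦ by rw [prodMetric_neg_left, hv.2, neg_zero]⟩
  · have h := hv.1.1
    simp only [form, Prod.fst_neg, PiLp.neg_apply] at h ⊢
    linarith
  · have h := hv.1.2
    simp only [form, Prod.snd_neg, PiLp.neg_apply] at h ⊢
    linarith

theorem IsImmersedSurface.shapeOp_neg (hψ : IsImmersedSurface c₁ c₂ ψ) (ξ : M → Amb × Amb)
    {p : M} (u : TangentSpace (𝓡 2) p) :
    shapeOp c₁ c₂ ψ (fun q ↦ -ξ q) p u = -shapeOp c₁ c₂ ψ ξ p u := by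
  rw [hψ.shapeOp_eq, hψ.shapeOp_eq, mvfderiv_fun_neg, neg_apply,
    hψ.tanPart_neg]

variable [IsManifold (𝓡 2) ∞ M] {C S : ℝ} {U : Set M}
  {e₁ e₂ : ∀ q : M, TangentSpace (𝓡 2) q} {ξ₁ ξ₂ : M → Amb × Amb}

namespace IsSpecialFrame

variable (h : IsSpecialFrame c₁ c₂ ψ C S U e₁ e₂ ξ₁ ξ₂) (hψ : IsImmersedSurface c₁ c₂ ψ)
include h

/-- The roles within both pairs are exchanged. The sign on `ξ₂` replaces its shape coefficient by
the negative, so that both connection formulas acquire the factor `-(S / C)`. -/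
theorem isAdaptedFrame_swap : IsAdaptedFrame c₂ c₁ (fun q ↦ (ψ q).swap) U e₂ e₁
    (fun q ↦ -(ξ₂ q).swap) (fun q ↦ (ξ₁ q).swap) where
  smooth_tangent q hq := (h.smooth_tangent q hq).symm
  smooth_normal q hq :=
    ⟨ContMDiffAt.neg (h.smooth_normal q hq).2.swap, (h.smooth_normal q hq).1.swap⟩
  isNormal q hq :=
    ⟨(isNormal_swap_iff.2 (h.isNormal q hq).2).neg, isNormal_swap_iff.2 (h.isNormal q hq).1⟩
  orthonormal_tangent q hq := by
    obtain ⟨h1, h2, h3⟩ := h.orthonormal_tangent q hq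
    rw [TanOrthonormal, indMetric_swap]
    exact ⟨h2, h1, by rw [← h3, indMetric, indMetric, prodMetric_comm]⟩
  orthonormal_normal q hq := by
    obtain ⟨h1, h2, h3⟩ := h.orthonormal_normal q hq
    refine ⟨?_, ?_, ?_⟩
    · rw [prodMetric_neg_left, prodMetric_neg_right, neg_neg, prodMetric_swap, h2]
    · rw [prodMetric_swap, h1]
    · rw [prodMetric_neg_left, prodMetric_swap, prodMetric_comm, h3, neg_zero]

include hψ

theorem fTensor_tTensor_swap {q : M} (hq : q ∈ U) :
    fTensor c₂ c₁ (fun q ↦ (ψ q).swap) q (e₂ q) = -((C ^ 2 - S ^ 2) • e₂ q) ∧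
    fTensor c₂ c₁ (fun q ↦ (ψ q).swap) q (e₁ q) = e₁ q ∧
    tTensor c₂ c₁ (fun q ↦ (ψ q).swap) q (-(ξ₂ q).swap) = (C ^ 2 - S ^ 2) • -(ξ₂ q).swap ∧
    tTensor c₂ c₁ (fun q ↦ (ψ q).swap) q (ξ₁ q).swap = -(ξ₁ q).swap := by
  refine ⟨?_, ?_, ?_, ?_⟩
  · rw [hψ.fTensor_swap, h.fTensor_e₂ hψ hq]
  · rw [hψ.fTensor_swap, h.fTensor_e₁ hψ hq, neg_neg]
  · have hneg (v : Amb × Amb) : tTensor c₁ c₂ ψ q (-v) = -tTensor c₁ c₂ ψ q v := by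
      rw [tTensor, tTensor, ← hψ.norPart_neg]
      congr 1
    rw [← Prod.swap_neg, hψ.tTensor_swap, hneg, h.tTensor_ξ₂ hψ hq, neg_neg]
    ext1 <;> simp
  · rw [hψ.tTensor_swap, h.tTensor_ξ₁ hψ hq]

theorem hasSpecialShape_swap : HasSpecialShape c₂ c₁ (fun q ↦ (ψ q).swap) U e₂ e₁
    (fun q ↦ -(ξ₂ q).swap) (fun q ↦ (ξ₁ q).swap)
    (fun q ↦ -shapeCoeff₂ c₂ C S ψ e₁ e₂ q) (shapeCoeff₁ c₁ ψ e₂ ξ₁) := by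
  intro q hq
  obtain ⟨h1, h2, h3, h4⟩ := h.hasSpecialShape hψ q hq
  simp only [hψ.swap.shapeOp_neg, shapeOp_swap]
  exact ⟨by rw [h4, neg_zero], by rw [h3, neg_smul], h2, h1⟩

theorem connection_swap {q : M} (hq : q ∈ U) {X : ∀ q : M, TangentSpace (𝓡 2) q}
    (hX : SmoothFieldAt X q) :
    indMetric c₂ c₁ (fun q ↦ (ψ q).swap) q
        (leviCivita c₂ c₁ (fun q ↦ (ψ q).swap) X e₂ q) (e₁ q) =
      -(S / C) * -shapeCoeff₂ c₂ C S ψ e₁ e₂ q *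
        indMetric c₂ c₁ (fun q ↦ (ψ q).swap) q (X q) (e₁ q) := by
  rw [leviCivita_swap, indMetric_swap, (h.connection_eq hψ hq hX).2]
  ring

theorem normalConnection_swap {q : M} (hq : q ∈ U) (u : TangentSpace (𝓡 2) q) :
    prodMetric c₂ c₁ (normalConn c₂ c₁ (fun q ↦ (ψ q).swap) (fun q ↦ -(ξ₂ q).swap) q u)
        (ξ₁ q).swap =
      -(S / C) * shapeCoeff₁ c₁ ψ e₂ ξ₁ q *
        indMetric c₂ c₁ (fun q ↦ (ψ q).swap) q u (e₂ q) := by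
  have hn := isNormal_swap_iff.2 (h.isNormal q hq).1
  rw [hψ.swap.prodMetric_normalConn _ _ hn, mvfderiv_fun_neg, neg_apply,
    prodMetric_neg_left, mvfderiv_swap, prodMetric_swap,
    ← hψ.prodMetric_normalConn _ _ (h.isNormal q hq).1, (h.normalConnection_eq hψ hq u).2,
    indMetric_swap]
  ring

end IsSpecialFrame

end SwappedFrame

end ConstantAngle

end

open ConstantAngle in
theorem mainTheorem9 (c₁ c₂ : ℝ) (_hc : ¬ (c₁ = 0 ∧ c₂ = 0))
    {M : Type*} [TopologicalSpace M] [T2Space M] [SecondCountableTopology M]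
    [ChartedSpace (EuclideanSpace ℝ (Fin 2)) M] [IsManifold (𝓡 2) ∞ M]
    (ψ : M → Amb × Amb) (_hψ : IsImmersedSurface c₁ c₂ ψ)
    (θ : ℝ) (_hθ : θ ∈ Set.Icc 0 (Real.pi / 2)) :
    (∀ l₂ ∈ Set.Ioo (-1 : ℝ) 1, Real.cos (2 * θ) = l₂ →
      (∀ p, HasPrincipalValuesAt c₁ c₂ ψ p (-1) l₂) →
      (∀ p : M, ∃ U : Set M, IsOpen U ∧ p ∈ U ∧
        ∃ (e₁ e₂ : ∀ q : M, TangentSpace (𝓡 2) q) (ξ₁ ξ₂ : M → Amb × Amb) (μ₁ μ₂ : M → ℝ),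
          IsAdaptedFrame c₁ c₂ ψ U e₁ e₂ ξ₁ ξ₂ ∧
          ContMDiffOn (𝓡 2) 𝓘(ℝ, ℝ) ∞ μ₁ U ∧ ContMDiffOn (𝓡 2) 𝓘(ℝ, ℝ) ∞ μ₂ U ∧
          (∀ q ∈ U, fTensor c₁ c₂ ψ q (e₁ q) = -e₁ q ∧
            fTensor c₁ c₂ ψ q (e₂ q) = Real.cos (2 * θ) • e₂ q ∧
            tTensor c₁ c₂ ψ q (ξ₁ q) = ξ₁ q ∧
            tTensor c₁ c₂ ψ q (ξ₂ q) = -(Real.cos (2 * θ) • ξ₂ q)) ∧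
          HasSpecialShape c₁ c₂ ψ U e₁ e₂ ξ₁ ξ₂ μ₁ μ₂ ∧
          (∀ q ∈ U, ∀ X : ∀ q : M, TangentSpace (𝓡 2) q, SmoothFieldAt X q →
            indMetric c₁ c₂ ψ q (leviCivita c₁ c₂ ψ X e₁ q) (e₂ q)
              = -Real.tan θ * μ₂ q * indMetric c₁ c₂ ψ q (X q) (e₁ q) ∧
            prodMetric c₁ c₂ (normalConn c₁ c₂ ψ ξ₁ q (X q)) (ξ₂ q)
              = -Real.tan θ * μ₁ q * indMetric c₁ c₂ ψ q (X q) (e₂ q))) ∧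
      ∀ p : M, HasGaussianCurvatureAt c₁ c₂ ψ p (c₂ * Real.sin θ ^ 2) ∧
        HasNormalCurvatureAt c₁ c₂ ψ p 0) ∧
    (∀ l₁ ∈ Set.Ioo (-1 : ℝ) 1, Real.cos (2 * θ) = l₁ →
      (∀ p, HasPrincipalValuesAt c₁ c₂ ψ p l₁ 1) →
      (∀ p : M, ∃ U : Set M, IsOpen U ∧ p ∈ U ∧
        ∃ (e₁ e₂ : ∀ q : M, TangentSpace (𝓡 2) q) (ξ₁ ξ₂ : M → Amb × Amb) (μ₁ μ₂ : M → ℝ),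
          IsAdaptedFrame c₁ c₂ ψ U e₁ e₂ ξ₁ ξ₂ ∧
          ContMDiffOn (𝓡 2) 𝓘(ℝ, ℝ) ∞ μ₁ U ∧ ContMDiffOn (𝓡 2) 𝓘(ℝ, ℝ) ∞ μ₂ U ∧
          (∀ q ∈ U, fTensor c₁ c₂ ψ q (e₁ q) = Real.cos (2 * θ) • e₁ q ∧
            fTensor c₁ c₂ ψ q (e₂ q) = e₂ q ∧
            tTensor c₁ c₂ ψ q (ξ₁ q) = -(Real.cos (2 * θ) • ξ₁ q) ∧
            tTensor c₁ c₂ ψ q (ξ₂ q) = -ξ₂ q) ∧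
          HasSpecialShape c₁ c₂ ψ U e₁ e₂ ξ₁ ξ₂ μ₁ μ₂ ∧
          (∀ q ∈ U, ∀ X : ∀ q : M, TangentSpace (𝓡 2) q, SmoothFieldAt X q →
            indMetric c₁ c₂ ψ q (leviCivita c₁ c₂ ψ X e₁ q) (e₂ q)
              = -Real.cot θ * μ₁ q * indMetric c₁ c₂ ψ q (X q) (e₂ q) ∧
            prodMetric c₁ c₂ (normalConn c₁ c₂ ψ ξ₁ q (X q)) (ξ₂ q)
              = -Real.cot θ * μ₂ q * indMetric c₁ c₂ ψ q (X q) (e₁ q))) ∧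
      ∀ p : M, HasGaussianCurvatureAt c₁ c₂ ψ p (c₁ * Real.cos θ ^ 2) ∧
        HasNormalCurvatureAt c₁ c₂ ψ p 0) := by
  refine ⟨?_, ?_⟩
  · rintro l₂ hl rfl h
    obtain ⟨hC, hS⟩ := cos_pos_and_sin_pos _hθ hl
    simp only [Real.cos_two_mul'] at h
    have hframe := _hψ.exists_isSpecialFrame hC hS (Real.cos_sq_add_sin_sq θ) h
    refine ⟨fun p ↦ ?_, fun p ↦ ?_⟩
    · obtain ⟨U, hp, e₁, e₂, ξ₁, ξ₂, hf⟩ := hframe p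
      refine ⟨U, hf.isOpen, hp, e₁, e₂, ξ₁, ξ₂, _, _, hf.toIsAdaptedFrame,
        hf.contMDiffOn_shapeCoeff₁ _hψ, hf.contMDiffOn_shapeCoeff₂ _hψ, fun q hq ↦ ?_,
        hf.hasSpecialShape _hψ, fun q hq X hX ↦ ?_⟩
      · rw [Real.cos_two_mul']
        exact ⟨hf.fTensor_e₁ _hψ hq, hf.fTensor_e₂ _hψ hq, hf.tTensor_ξ₁ _hψ hq,
          hf.tTensor_ξ₂ _hψ hq⟩
      · rw [Real.tan_eq_sin_div_cos]
        exact ⟨(hf.connection_eq _hψ hq hX).1, (hf.normalConnection_eq _hψ hq (X q)).1⟩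
    · obtain ⟨U, hp, e₁, e₂, ξ₁, ξ₂, hf⟩ := hframe p
      exact ⟨hf.hasGaussianCurvatureAt _hψ hp, hf.hasNormalCurvatureAt _hψ hp⟩
  · rintro l₁ hl rfl h
    -- For the swapped immersion the roles are `C = sin θ` and `S = cos θ`, so `S / C` becomes `cot
    -- θ`.
    obtain ⟨hS, hC⟩ := cos_pos_and_sin_pos _hθ hl
    have hcos : Real.cos (2 * θ) = -(Real.sin θ ^ 2 - Real.cos θ ^ 2) := by
      rw [Real.cos_two_mul', neg_sub]
    have h' (p : M) : HasPrincipalValuesAt c₂ c₁ (fun q ↦ (ψ q).swap) p (-1)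
        (Real.sin θ ^ 2 - Real.cos θ ^ 2) := by
      simpa only [hcos, neg_neg] using (h p).swap _hψ
    have hframe := _hψ.swap.exists_isSpecialFrame hC hS (Real.sin_sq_add_cos_sq θ) h'
    refine ⟨fun p ↦ ?_, fun p ↦ ?_⟩
    · obtain ⟨U, hp, e₁, e₂, ξ₁, ξ₂, hf⟩ := hframe p
      -- The frame of the swapped immersion is swapped once more; two swaps give back `ψ`
      -- definitionally.
      refine ⟨U, hf.isOpen, hp, e₂, e₁, _, _, _, _, hf.isAdaptedFrame_swap,
        (hf.contMDiffOn_shapeCoeff₂ _hψ.swap).neg, hf.contMDiffOn_shapeCoeff₁ _hψ.swap,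
        fun q hq ↦ ?_, hf.hasSpecialShape_swap _hψ.swap, fun q hq X hX ↦ ?_⟩
      · obtain ⟨h1, h2, h3, h4⟩ := hf.fTensor_tTensor_swap _hψ.swap hq
        rw [hcos]
        refine ⟨?_, h2, ?_, h4⟩
        · rw [neg_smul]; exact h1
        · rw [neg_smul, neg_neg]; exact h3
      · rw [Real.cot_eq_cos_div_sin]
        exact ⟨hf.connection_swap _hψ.swap hq hX, hf.normalConnection_swap _hψ.swap hq (X q)⟩
    · obtain ⟨U, hp, e₁, e₂, ξ₁, ξ₂, hf⟩ := hframe p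
      exact ⟨(hf.hasGaussianCurvatureAt _hψ.swap hp).of_swap,
        (hf.hasNormalCurvatureAt _hψ.swap hp).of_swap⟩
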